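/- Let $d\ge 1$, $T\ge 2$, $\mathcal X=\{x\in\mathbb R^d:\|x\|_2\le 1,\ x_1=\tfrac12\}$, and let $\mathcal F_4^{\mathrm{lin}}$ be the class of all functions $x\mapsto\langle\theta,x\rangle$ on $\mathcal X$, $\theta\in\mathbb R^d$, with $\langle\theta,x\rangle^2\le 4$ for all $x\in\mathcal X$. Put $$N=\Big\lceil\Big(\frac{T}{d\log T}\Big)^{1/5}\Big\rceil,\qquad \mathcal Z=\{0,\tfrac1N,\dots,\tfrac{N-1}N,1\}.$$ Online protocol: an oblivious adversary fixes $(x_1,y_1),\dots,(x_T,y_T)\in\mathcal X\times\{0,1\}$ in advance (possibly with knowledge of the algorithm). In round $t=1,\dots,T$ the context $x_t$ is revealed, the forecaster outputs a probability distribution $\mathcal P_t$ on $\mathcal Z$, a prediction $p_t\sim\mathcal P_t$ is drawn, and $y_t$ is revealed. The contextual swap regret for the squared loss is $$\mathsf{SReg}_{\mathcal F_4^{\mathrm{lin}}}=\sup_{\{f_p\in\mathcal F_4^{\mathrm{lin}}\}_{p\in\mathcal Z}}\ \sum_{t=1}^T\big[(p_t-y_t)^2-(f_{p_t}(x_t)-y_t)^2\big].$$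 **Theorem.** There are a single forecasting algorithm, namely a program for a real random-access machine (unit-cost exact real arithmetic $+,-,\times,/$ and comparisons) with parameters $d,T,N$, and absolute constants $C$ and $K$ such that the following holds for all $d\ge1$, $T\ge2$ and all sequences $(x_t,y_t)_{t\le T}$ in $\mathcal X\times\{0,1\}$. 1. (Efficiency.) Over the $T$ rounds, the algorithm computes the probability vectors $\mathcal P_1,\dots,\mathcal P_T$ in at most $K(d+T)^K$ steps in total. Here $\mathcal P_t$ depends only on $d,T,N$, on $(x_1,y_1),\dots,(x_{t-1},y_{t-1})$ and on $x_t$; in particular it is deterministic, and $p_1,\dots,p_T$ are independent. 2. (High probability.) For every $\delta\in(0,1]$, with probability at least $1-\delta$, $$\mathsf{SReg}_{\mathcal F_4^{\mathrm{lin}}}\le C\Big(T^{3/5}(d\log T)^{2/5}+T^{3/5}(d\log T)^{-1/10}\sqrt{\log(1/\delta)}\Big).$$ 3. (Expectation.) $\mathbb E\big[\mathsf{SReg}_{\mathcal F_4^{\mathrm{lin}}}\big]\le C\,T^{3/5}(d\log T)^{2/5}$, where the expectation is over the draws $p_t\sim\mathcal P_t$. -/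

import Mathlib

open MeasureTheory

noncomputable section

/-! ### Real random-access machine

Programs of a deterministic real RAM in structured form.  Index registers hold natural numbers;
real arrays are addressed by an array name and three natural-number indices.  Index arithmetic is
`+` and truncated `-`; real arithmetic is exact `+`, `-`, `*`, `/` with rational constants; tests
are `≤` on indices and on reals.  Every node of an expression and every executed command costs one
step. -/

namespace RealRAM

structure Store where
  reg : ℕ → ℕ
  cell : ℕ → ℕ → ℕ → ℕ → ℝ

inductive IExp where
  | lit (n : ℕ)
  | reg (v : ℕ)
  | add (e₁ e₂ : IExp)
  | sub (e₁ e₂ : IExp)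

namespace IExp

def eval (s : Store) : IExp → ℕ
  | lit n => n
  | reg v => s.reg v
  | add e₁ e₂ => e₁.eval s + e₂.eval s
  | sub e₁ e₂ => e₁.eval s - e₂.eval s

def size : IExp → ℕ
  | lit _ => 1
  | reg _ => 1
  | add e₁ e₂ => e₁.size + e₂.size + 1
  | sub e₁ e₂ => e₁.size + e₂.size + 1

end IExp

/-- Real expressions; `cell a i j k` reads entry `(i, j, k)` of the array named `a`. -/
inductive RExp where
  | lit (q : ℚ)
  | ofIndex (e : IExp)
  | cell (a : ℕ) (i j k : IExp)
  | add (e₁ e₂ : RExp)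
  | sub (e₁ e₂ : RExp)
  | mul (e₁ e₂ : RExp)
  | div (e₁ e₂ : RExp)

namespace RExp

def eval (s : Store) : RExp → ℝ
  | lit q => (q : ℝ)
  | ofIndex e => (e.eval s : ℝ)
  | cell a i j k => s.cell a (i.eval s) (j.eval s) (k.eval s)
  | add e₁ e₂ => e₁.eval s + e₂.eval s
  | sub e₁ e₂ => e₁.eval s - e₂.eval s
  | mul e₁ e₂ => e₁.eval s * e₂.eval s
  | div e₁ e₂ => e₁.eval s / e₂.eval s

def size : RExp → ℕ
  | lit _ => 1
  | ofIndex e => e.size + 1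
  | cell _ i j k => i.size + j.size + k.size + 1
  | add e₁ e₂ => e₁.size + e₂.size + 1
  | sub e₁ e₂ => e₁.size + e₂.size + 1
  | mul e₁ e₂ => e₁.size + e₂.size + 1
  | div e₁ e₂ => e₁.size + e₂.size + 1

end RExp

namespace Store

def setReg (s : Store) (v n : ℕ) : Store :=
  { s with reg := Function.update s.reg v n }

def setCell (s : Store) (a i j k : ℕ) (r : ℝ) : Store :=
  { s with cell := fun a' i' j' k' =>
      if a' = a ∧ i' = i ∧ j' = j ∧ k' = k then r else s.cell a' i' j' k' }

end Store

/-- Commands. `ifIndex e₁ e₂ c c'` and `ifReal e₁ e₂ c c'` execute `c` if `e₁ ≤ e₂` and `c'`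
otherwise. `loop v e c` evaluates the bound `e` once, to `n` say, and executes `c` for
`v = 0, 1, …, n - 1`. -/
inductive Cmd where
  | setReg (v : ℕ) (e : IExp)
  | setCell (a : ℕ) (i j k : IExp) (e : RExp)
  | seq (c₁ c₂ : Cmd)
  | ifIndex (e₁ e₂ : IExp) (c c' : Cmd)
  | ifReal (e₁ e₂ : RExp) (c c' : Cmd)
  | loop (v : ℕ) (e : IExp) (c : Cmd)

namespace Cmd

/-- State after the first `n` passes of a loop with counter `v` and body `f`. -/
def iter (v : ℕ) (f : Store → Store) (s : Store) : ℕ → Store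
  | 0 => s
  | n + 1 => f ((iter v f s n).setReg v n)

open Classical in
/-- The store after executing a command. -/
def exec : Cmd → Store → Store
  | setReg v e, s => s.setReg v (e.eval s)
  | setCell a i j k e, s => s.setCell a (i.eval s) (j.eval s) (k.eval s) (e.eval s)
  | seq c₁ c₂, s => c₂.exec (c₁.exec s)
  | ifIndex e₁ e₂ c c', s => if e₁.eval s ≤ e₂.eval s then c.exec s else c'.exec s
  | ifReal e₁ e₂ c c', s => if e₁.eval s ≤ e₂.eval s then c.exec s else c'.exec s
  | loop v e c, s => iter v c.exec s (e.eval s)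

open Classical in
/-- The number of steps that executing a command takes. -/
def time : Cmd → Store → ℕ
  | setReg _ e, _ => e.size + 1
  | setCell _ i j k e, _ => i.size + j.size + k.size + e.size + 1
  | seq c₁ c₂, s => c₁.time s + c₂.time (c₁.exec s)
  | ifIndex e₁ e₂ c c', s =>
      e₁.size + e₂.size + 1 + if e₁.eval s ≤ e₂.eval s then c.time s else c'.time s
  | ifReal e₁ e₂ c c', s =>
      e₁.size + e₂.size + 1 + if e₁.eval s ≤ e₂.eval s then c.time s else c'.time s
  | loop v e c, s =>
      e.size + 1 +
        ∑ n ∈ Finset.range (e.eval s), (c.time ((iter v c.exec s n).setReg v n) + 1)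

end Cmd

end RealRAM

open RealRAM

/-! ### Online forecasting algorithms -/

/-- `{x ∈ ℝᵈ : ‖x‖₂ ≤ 1, x₁ = 1/2}`. -/
def contextSet (d : ℕ) : Set (EuclideanSpace ℝ (Fin d)) :=
  {x | ‖x‖ ≤ 1 ∧ ∀ i : Fin d, (i : ℕ) = 0 → x i = 1 / 2}

/-- An online forecasting algorithm. `init` is executed once; in every round `predict` is executed
when the context has been revealed, and `update` when the label has been revealed. The memory is
kept between the rounds. -/
structure OnlineProgram where
  init : Cmd
  predict : Cmd
  update : Cmd

namespace OnlineProgram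

/-- The initial memory: registers `0, 1, 2` hold the dimension `d`, the horizon `T` and the
discretization parameter `N`; everything else is `0`. -/
def blank (d T N : ℕ) : Store where
  reg v := if v = 0 then d else if v = 1 then T else if v = 2 then N else 0
  cell _ _ _ _ := 0

/-- The context is written to the entries `(j, 0, 0)`, `j < d`, of array `0`. -/
def loadContext {d : ℕ} (s : Store) (x : contextSet d) : Store :=
  { s with cell := fun a i j k =>
      if h : a = 0 ∧ i < d ∧ j = 0 ∧ k = 0 then x.1 ⟨i, h.2.1⟩ else s.cell a i j k }

/-- The label is written to the entry `(0, 0, 0)` of array `1`. -/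
def loadLabel (s : Store) (y : ℝ) : Store := s.setCell 1 0 0 0 y

variable (A : OnlineProgram) (d T N : ℕ)

/-- The memory at the beginning of round `t`, `t = 0, 1, …`. -/
def memory (x : ℕ → contextSet d) (y : ℕ → ℝ) : ℕ → Store
  | 0 => A.init.exec (blank d T N)
  | t + 1 => A.update.exec
      (loadLabel (A.predict.exec (loadContext (memory x y t) (x t))) (y t))

/-- The memory in round `t` between `predict` and `update`. -/
def midMemory (x : ℕ → contextSet d) (y : ℕ → ℝ) (t : ℕ) : Store :=
  A.predict.exec (loadContext (A.memory d T N x y t) (x t))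

/-- The total number of steps over `T` rounds. -/
def totalTime (x : ℕ → contextSet d) (y : ℕ → ℝ) : ℕ :=
  A.init.time (blank d T N) +
    ∑ t ∈ Finset.range T,
      (A.predict.time (loadContext (A.memory d T N x y t) (x t)) +
        A.update.time (loadLabel (A.midMemory d T N x y t) (y t)))

/-- In each of the `T` rounds, entry `(k, 0, 0)` of array `2` holds, after `predict`, the
probability `P t k` that the prediction of that round is the grid point `k / N`. -/
def Outputs (x : ℕ → contextSet d) (y : ℕ → ℝ)
    (P : Fin T → PMF (Fin (N + 1))) : Prop :=
  ∀ (t : Fin T) (k : Fin (N + 1)), (A.midMemory d T N x y t).cell 2 k 0 0 = (P t k).toReal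

end OnlineProgram

/-- The joint law of the predictions: in round `t` the (index of the) prediction is drawn from
`P t`. The `P t` do not depend on earlier draws, so the draws are independent. -/
def predictionLaw {T N : ℕ} (P : Fin T → PMF (Fin (N + 1))) : Measure (Fin T → Fin (N + 1)) :=
  Measure.pi fun t => (P t).toMeasure

/-! ### Hypothesis classes and contextual swap regret -/

/-- The linear functions `x ↦ ⟨θ, x⟩`, `θ ∈ ℝᵈ`, on the context set. -/
def linearClass (d : ℕ) : Set (contextSet d → ℝ) :=
  {f | ∃ θ : EuclideanSpace ℝ (Fin d), ∀ x : contextSet d,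
    f x = inner ℝ θ (x : EuclideanSpace ℝ (Fin d))}

/-- `ℱ_β = {f ∈ ℱ : f(x)² ≤ β for all x}`. -/
def boundedSubclass {X : Type*} (ℱ : Set (X → ℝ)) (β : ℝ) : Set (X → ℝ) :=
  {f | f ∈ ℱ ∧ ∀ x, f x ^ 2 ≤ β}

/-- Contextual swap regret of the squared loss of the predictions `k / N`, `k = p 0, …, p (T - 1)`,
against all comparator profiles `(f_k)` in `ℱ`. Every term of the sum is at most `1` if the labels
are in `{0, 1}`, so that the supremum is that of a set bounded above. -/
def swapRegret {X : Type*} (ℱ : Set (X → ℝ)) {T N : ℕ} (x : Fin T → X) (y : Fin T → ℝ)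
    (p : Fin T → Fin (N + 1)) : ℝ :=
  ⨆ f : Fin (N + 1) → ℱ,
    ∑ t, ((((p t : ℕ) : ℝ) / N - y t) ^ 2 - ((f (p t) : X → ℝ) (x t) - y t) ^ 2)

/-- `N = ⌈(T / (d log T))^{1/5}⌉`. -/
def gridSize (d T : ℕ) : ℕ := ⌈((T : ℝ) / (d * Real.log T)) ^ (1 / 5 : ℝ)⌉₊

end

/-! ### Recursive least squares -/

section Ridge

open Matrix

variable {n : Type*} [Fintype n]

/-! For every grid point k/N the forecaster runs its own online ridge regression, in which round t
carries the weight that the forecast of round t puts on k/N. There is no circularity: the ridge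
predictions depend only on past rounds and the current context, and the regret bound `ridge_regret`
allows any weights in [0, 1], even ones chosen after the predictions are known. It gives regret at
most ‖ϑ‖² + d log (d + T) for each grid point, by the log-determinant potential.

The forecast is calibrated against these regressions. Let q_k be the ridge prediction of grid point
k/N, truncated to [0, 1]. Since q_0 ≥ 0 and q_N ≤ 1, a discrete intermediate value argument gives κ
with q_κ ≥ κ/N and q_{κ+1} ≤ (κ+1)/N. Randomizing between these two points so that the mean of q_k -
k/N vanishes cancels the dependence on the label, and the expected excess loss over q_k is at most
1/(4N²) (`two_point_calibration`). Adding both parts, the pseudo swap regret is at most T/(4N²) + (N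
+ 1)(R² + d log (d + T)) against vectors of norm at most R (`forecast_pseudo_regret`).

The forecasts are deterministic functions of an oblivious sequence, so the draws are independent.
The condition x₁ = 1/2 forces every admissible θ to have norm at most 4, so comparator profiles have
a finite net of cardinality at most (10dT + 1)^(d(N+1)). Hoeffding's inequality and a union bound
over it cost a term of order √(T (dN log (dT) + log (1/δ))), which dominates the dN log (dT) of the
regressions. With N of order (T / (d log T))^(1/5) this term and T/N² balance at T^(3/5) (d log
T)^(2/5). If d log T ≥ T, that rate already exceeds the trivial bound T. The expectation follows
with δ = 1/T.

The running time is read off the syntax: loop bounds involve only the parameters d, T, N, which are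
never overwritten. Correctness is proved by loop invariants, using that loop passes act on disjoint
parts of the memory. -/

theorem Matrix.PosDef.inv_quadratic_nonneg [DecidableEq n] {A B : Matrix n n ℝ} (hA : A.PosDef) (hAB : A * B = 1)
    (x : n → ℝ) : 0 ≤ x ⬝ᵥ B *ᵥ x := by
  have h := hA.posSemidef.dotProduct_mulVec_nonneg (B *ᵥ x)
  rwa [mulVec_mulVec, hAB, one_mulVec, star_trivial, dotProduct_comm] at h

theorem Matrix.PosDef.add_smul_vecMulVec_self {A : Matrix n n ℝ} (hA : A.PosDef) {w : ℝ}
    (hw : 0 ≤ w) (x : n → ℝ) : (A + w • vecMulVec x x).PosDef := by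
  refine hA.add_posSemidef (PosSemidef.smul ?_ hw)
  simpa using posSemidef_vecMulVec_self_star x

variable [DecidableEq n]

/-- The Sherman–Morrison formula for a symmetric rank-one update. -/
theorem Matrix.sherman_morrison_symm {A B : Matrix n n ℝ} (hAB : A * B = 1) (hB : Bᵀ = B) (w : ℝ)
    (x : n → ℝ) (h : 1 + w * (x ⬝ᵥ B *ᵥ x) ≠ 0) :
    (A + w • vecMulVec x x) *
      (B - (w / (1 + w * (x ⬝ᵥ B *ᵥ x))) • vecMulVec (B *ᵥ x) (B *ᵥ x)) = 1 := by
  have h1 : x ᵥ* B = B *ᵥ x := by rw [← mulVec_transpose, hB]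
  rw [Matrix.add_mul, Matrix.mul_sub, Matrix.mul_sub, hAB, Matrix.mul_smul, Matrix.mul_smul,
    mul_vecMulVec, mulVec_mulVec, hAB, one_mulVec, Matrix.smul_mul, Matrix.smul_mul,
    vecMulVec_mul, h1, vecMulVec_mul_vecMulVec]
  ext i j
  simp only [add_apply, sub_apply, smul_apply, vecMulVec_apply, smul_eq_mul, Pi.smul_apply]
  field_simp
  ring

/-- The matrix determinant lemma; it makes the sum over rounds of log (1 + w xᵀBx) telescope to log
det A. -/
theorem Matrix.det_add_smul_vecMulVec_self {A B : Matrix n n ℝ} (hAB : A * B = 1) (w : ℝ)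
    (x : n → ℝ) : (A + w • vecMulVec x x).det = A.det * (1 + w * (x ⬝ᵥ B *ᵥ x)) := by
  have hA : IsUnit A.det := A.isUnit_iff_isUnit_det.1 (IsUnit.of_mul_eq_one B hAB)
  rw [← smul_vecMulVec, vecMulVec_eq Unit, det_add_replicateCol_mul_replicateRow hA,
    inv_eq_right_inv hAB, det_unique (n := Unit), add_apply, one_apply_eq, ← replicateRow_vecMul,
    replicateRow_mul_replicateCol_apply, dotProduct_smul, ← dotProduct_mulVec, smul_eq_mul]

/-- The quadratic form is the weighted, regularized loss of ϑ minus the minimum of that loss,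
attained at θ. A new observation adds its loss at ϑ, while the minimum grows by the loss at the old
minimizer divided by 1 + w xᵀBx. -/
theorem ridge_quadratic_step {A B : Matrix n n ℝ} (hA : A.PosDef) (hAB : A * B = 1) {w : ℝ}
    (hw : 0 ≤ w) (x θ ϑ : n → ℝ) (y : ℝ) :
    (ϑ - (θ + (w / (1 + w * (x ⬝ᵥ B *ᵥ x)) * (y - x ⬝ᵥ θ)) • B *ᵥ x)) ⬝ᵥ
        (A + w • vecMulVec x x) *ᵥ
          (ϑ - (θ + (w / (1 + w * (x ⬝ᵥ B *ᵥ x)) * (y - x ⬝ᵥ θ)) • B *ᵥ x)) =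
      (ϑ - θ) ⬝ᵥ A *ᵥ (ϑ - θ) + w * (x ⬝ᵥ ϑ - y) ^ 2 -
        w * (x ⬝ᵥ θ - y) ^ 2 / (1 + w * (x ⬝ᵥ B *ᵥ x)) := by
  have hv := hA.inv_quadratic_nonneg hAB x
  set v := x ⬝ᵥ B *ᵥ x with hvdef
  have h0 : 1 + w * v ≠ 0 := by positivity
  set c := w / (1 + w * v) * (y - x ⬝ᵥ θ) with hc
  set u := B *ᵥ x with hu
  have hAu : A *ᵥ u = x := by rw [hu, mulVec_mulVec, hAB, one_mulVec]
  have hAs : Aᵀ = A := by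
    have := hA.isHermitian; rwa [IsHermitian, conjTranspose_eq_transpose_of_trivial] at this
  set e := ϑ - θ with he
  have h1 : ϑ - (θ + c • u) = e - c • u := by rw [he]; abel
  have huAe : u ⬝ᵥ A *ᵥ e = x ⬝ᵥ e := by
    rw [dotProduct_mulVec, ← mulVec_transpose, hAs, hAu]
  have hxe : x ⬝ᵥ ϑ = x ⬝ᵥ e + x ⬝ᵥ θ := by rw [he, dotProduct_sub]; ring
  rw [h1, hxe, add_mulVec, smul_mulVec, vecMulVec_mulVec, mulVec_sub, mulVec_smul, hAu]
  simp only [dotProduct_add, dotProduct_sub, sub_dotProduct, smul_dotProduct, dotProduct_smul,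
    smul_eq_mul, huAe, op_smul_eq_smul]
  rw [dotProduct_comm e x, dotProduct_comm u x, ← hvdef, hc]
  field_simp
  ring

/-- Each eigenvalue is positive, hence at most their sum. The sharper bound by arithmetic and
geometric means would only change constants inside a logarithm. -/
theorem Matrix.PosDef.det_le_trace_pow {A : Matrix n n ℝ} (hA : A.PosDef) :
    A.det ≤ A.trace ^ Fintype.card n := by
  have h1 := hA.isHermitian.det_eq_prod_eigenvalues
  have h2 := hA.isHermitian.trace_eq_sum_eigenvalues
  simp only [RCLike.ofReal_real_eq_id, id] at h1 h2
  rw [h1, h2]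
  calc _ ≤ ∏ _i : n, ∑ i, hA.isHermitian.eigenvalues i :=
        Finset.prod_le_prod (fun i _ => (hA.eigenvalues_pos i).le) fun i _ =>
          Finset.single_le_sum (f := hA.isHermitian.eigenvalues)
            (fun j _ => (hA.eigenvalues_pos j).le) (Finset.mem_univ i)
    _ = _ := by simp

/-- Split the left side in the proportions 1 - 1/(1 + wv) and 1/(1 + wv). In the first share bound
the loss by 1 and use 1 - 1/z ≤ log z; in the second pass from the truncated prediction q to the raw
prediction m. -/
theorem weighted_clipped_loss_le {w v q m y : ℝ} (hw : 0 ≤ w) (hw1 : w ≤ 1) (hv : 0 ≤ v)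
    (hq : (q - y) ^ 2 ≤ 1) (hqm : (q - y) ^ 2 ≤ (m - y) ^ 2) :
    w * (q - y) ^ 2 ≤ w * (m - y) ^ 2 / (1 + w * v) + Real.log (1 + w * v) := by
  have h0 : 0 < 1 + w * v := by positivity
  have hlog : 1 - (1 + w * v)⁻¹ ≤ Real.log (1 + w * v) := Real.one_sub_inv_le_log_of_pos h0
  have h1 : w * (q - y) ^ 2 * (1 - (1 + w * v)⁻¹) ≤ 1 * (1 - (1 + w * v)⁻¹) := by
    refine mul_le_mul_of_nonneg_right ?_ ?_
    · nlinarith [sq_nonneg (q - y)]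
    · rw [sub_nonneg]; exact inv_le_one_of_one_le₀ (by nlinarith)
  have h2 : w * (q - y) ^ 2 * (1 + w * v)⁻¹ ≤ w * (m - y) ^ 2 * (1 + w * v)⁻¹ := by
    gcongr
  rw [div_eq_mul_inv]
  linarith

/-- Regret of weighted online ridge regression with clipped predictions `q t`. -/
theorem ridge_regret (T : ℕ) (x θ : ℕ → n → ℝ) (B : ℕ → Matrix n n ℝ) (w y q : ℕ → ℝ)
    (hB0 : B 0 = 1) (hθ0 : θ 0 = 0)
    (hB : ∀ t < T, B (t + 1) = B t -
      (w t / (1 + w t * (x t ⬝ᵥ B t *ᵥ x t))) • vecMulVec (B t *ᵥ x t) (B t *ᵥ x t))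
    (hθ : ∀ t < T, θ (t + 1) = θ t +
      (w t / (1 + w t * (x t ⬝ᵥ B t *ᵥ x t)) * (y t - x t ⬝ᵥ θ t)) • B t *ᵥ x t)
    (hw : ∀ t < T, 0 ≤ w t) (hw1 : ∀ t < T, w t ≤ 1) (hx : ∀ t < T, x t ⬝ᵥ x t ≤ 1)
    (hq : ∀ t < T, (q t - y t) ^ 2 ≤ 1)
    (hqm : ∀ t < T, (q t - y t) ^ 2 ≤ (x t ⬝ᵥ θ t - y t) ^ 2) (ϑ : n → ℝ) :
    ∑ t ∈ Finset.range T, w t * ((q t - y t) ^ 2 - (x t ⬝ᵥ ϑ - y t) ^ 2) ≤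
      ϑ ⬝ᵥ ϑ + Fintype.card n * Real.log (Fintype.card n + T) := by
  -- Here A is the regularized Gram matrix 1 + ∑ w x xᵀ, known to the algorithm only through its
  -- inverse B. The last clause is the potential argument: regret so far plus the distance of ϑ from
  -- the current estimate, paid for by log det A.
  have key : ∀ t ≤ T, ∃ A : Matrix n n ℝ, A.PosDef ∧ A * B t = 1 ∧ (B t)ᵀ = B t ∧
      A.trace ≤ Fintype.card n + t ∧
      ∑ s ∈ Finset.range t, w s * ((q s - y s) ^ 2 - (x s ⬝ᵥ ϑ - y s) ^ 2) +
        (ϑ - θ t) ⬝ᵥ A *ᵥ (ϑ - θ t) ≤ ϑ ⬝ᵥ ϑ + Real.log A.det := by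
    intro t
    induction t with
    | zero =>
      intro _
      exact ⟨1, PosDef.one, by simp [hB0], by simp [hB0], by simp, by simp [hθ0]⟩
    | succ t ih =>
      intro ht
      have ht' : t < T := ht
      obtain ⟨A, hA, hAB, hBs, htr, hreg⟩ := ih ht'.le
      have hv := hA.inv_quadratic_nonneg hAB (x t)
      have h0 : 0 < 1 + w t * (x t ⬝ᵥ B t *ᵥ x t) := by have := hw t ht'; positivity
      refine ⟨A + w t • vecMulVec (x t) (x t), hA.add_smul_vecMulVec_self (hw t ht') _,
        ?_, ?_, ?_, ?_⟩
      · rw [hB t ht']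
        exact sherman_morrison_symm hAB hBs _ _ h0.ne'
      · rw [hB t ht', transpose_sub, hBs, transpose_smul, transpose_vecMulVec]
      · rw [trace_add, trace_smul, trace_vecMulVec, smul_eq_mul]
        push_cast
        have : w t * (x t ⬝ᵥ x t) ≤ 1 := by
          have h1 := hw t ht'
          have h2 := hw1 t ht'
          have h3 := hx t ht'
          nlinarith
        linarith
      · rw [Finset.sum_range_succ, hθ t ht', ridge_quadratic_step hA hAB (hw t ht'),
          det_add_smul_vecMulVec_self hAB, Real.log_mul hA.det_pos.ne' h0.ne']
        have := weighted_clipped_loss_le (hw t ht') (hw1 t ht') hv (hq t ht') (hqm t ht')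
        linarith
  obtain ⟨A, hA, -, -, htr, hreg⟩ := key T le_rfl
  have hquad := hA.posSemidef.dotProduct_mulVec_nonneg (ϑ - θ T)
  rw [star_trivial] at hquad
  have hdet : Real.log A.det ≤ Fintype.card n * Real.log (Fintype.card n + T) := by
    rw [← Real.log_pow]
    refine Real.log_le_log hA.det_pos (hA.det_le_trace_pow.trans ?_)
    exact pow_le_pow_left₀ hA.posSemidef.trace_nonneg htr _
  linarith

end Ridge

/-! ### Randomized rounding to the grid -/

/-- A two-point forecast that makes the bias vanish. -/
theorem two_point_calibration {a b h p q q' y : ℝ} (ha : 0 ≤ a) (hb : 0 ≤ b) (hab : 0 < a + b)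
    (hq : q = p + a) (hq' : q' = p + h - b) :
    b / (a + b) * ((p - y) ^ 2 - (q - y) ^ 2) + a / (a + b) * ((p + h - y) ^ 2 - (q' - y) ^ 2) ≤
      h ^ 2 / 4 := by
  -- The weights give the biases a and -b mean zero, so y cancels. With s = a + b, the bounds ab ≤
  -- s²/4 and s(2h - s) ≤ h² finish the proof.
  have : b / (a + b) * ((p - y) ^ 2 - (q - y) ^ 2) +
      a / (a + b) * ((p + h - y) ^ 2 - (q' - y) ^ 2) = a * b / (a + b) * (2 * h - (a + b)) := by
    subst hq hq'; field_simp; ring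
  rw [this, div_mul_eq_mul_div, div_le_iff₀ hab]
  have h4 : a * b ≤ (a + b) ^ 2 / 4 := by nlinarith [sq_nonneg (a - b)]
  have h5 : 0 ≤ a * b := mul_nonneg ha hb
  rcases le_total (2 * h) (a + b) with h6 | h6
  · exact (mul_nonpos_of_nonneg_of_nonpos h5 (by linarith)).trans (by positivity)
  · have h7 : a * b * (2 * h - (a + b)) ≤ (a + b) ^ 2 / 4 * (2 * h - (a + b)) :=
      mul_le_mul_of_nonneg_right h4 (by linarith)
    nlinarith [mul_nonneg hab.le (sq_nonneg (h - (a + b)))]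

/-! ### Concentration -/

section Concentration

open ProbabilityTheory

variable {T : ℕ} {α : Type*} [Fintype α] [MeasurableSpace α] [DiscreteMeasurableSpace α]

/-- Hoeffding's inequality for a finite family of sums over independent coordinates. -/
theorem pi_pmf_uniform_hoeffding (hT : 0 < T) (P : Fin T → PMF α) (G : Finset (Fin T → α → ℝ))
    (hG : G.Nonempty) {a b : ℝ} (hab : a < b) (hbd : ∀ h ∈ G, ∀ t k, h t k ∈ Set.Icc a b) {δ : ℝ}
    (hδ : 0 < δ) (hδ1 : δ ≤ 1) :
    (Measure.pi fun t => (P t).toMeasure).real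
      {p | ∃ h ∈ G, ∑ t, ∑ k, (P t k).toReal * h t k +
        (b - a) * Real.sqrt (T * (Real.log G.card + Real.log (1 / δ))) ≤ ∑ t, h t (p t)} ≤ δ := by
  set μ := Measure.pi fun t => (P t).toMeasure with hμ
  have hcard : (1 : ℝ) ≤ G.card := by exact_mod_cast hG.card_pos
  have hlog : 0 ≤ Real.log G.card + Real.log (1 / δ) :=
    add_nonneg (Real.log_nonneg hcard) (Real.log_nonneg (by rw [le_div_iff₀ hδ]; linarith))
  set ε := (b - a) * Real.sqrt (T * (Real.log G.card + Real.log (1 / δ))) with hε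
  have hε0 : 0 ≤ ε := mul_nonneg (by linarith) (Real.sqrt_nonneg _)
  have hone : ∀ h ∈ G, μ.real {p | ∑ t, ∑ k, (P t k).toReal * h t k + ε ≤ ∑ t, h t (p t)} ≤
      δ / G.card := by
    intro h hh
    have hmean : ∀ t, ∫ k, h t k ∂(P t).toMeasure = ∑ k, (P t k).toReal * h t k := fun t => by
      simp [PMF.integral_eq_sum]
    have hmean' : ∀ t, ∫ p, h t (p t) ∂μ = ∑ k, (P t k).toReal * h t k := fun t => by
      rw [← hmean]
      exact integral_comp_eval (μ := fun t => (P t).toMeasure) (i := t) (f := h t)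
        (measurable_of_finite _).aestronglyMeasurable
    have hind : iIndepFun (fun t (p : Fin T → α) => h t (p t) - ∫ p, h t (p t) ∂μ) μ :=
      iIndepFun_pi (μ := fun t => (P t).toMeasure)
        (X := fun t k => h t k - ∫ p, h t (p t) ∂μ) fun t => (measurable_of_finite _).aemeasurable
    have hsub : ∀ t ∈ (Finset.univ : Finset (Fin T)),
        HasSubgaussianMGF (fun p : Fin T → α => h t (p t) - ∫ p, h t (p t) ∂μ)
          ((‖b - a‖₊ / 2) ^ 2) μ := fun t _ =>
      hasSubgaussianMGF_of_mem_Icc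
        (((measurable_of_finite (h t)).comp (measurable_pi_apply t)).aemeasurable)
        (ae_of_all _ fun p => hbd h hh t (p t))
    have := HasSubgaussianMGF.measure_sum_ge_le_of_iIndepFun hind hsub hε0
    have hset : {p : Fin T → α | ∑ t, ∑ k, (P t k).toReal * h t k + ε ≤ ∑ t, h t (p t)} =
        {p | ε ≤ ∑ t, (h t (p t) - ∫ p, h t (p t) ∂μ)} := by
      ext p
      simp only [Set.mem_ofPred_eq, Finset.sum_sub_distrib, hmean']
      constructor <;> intro H <;> linarith
    rw [hset]
    refine this.trans ?_
    -- A variable with values in [a, b] has variance proxy ((b - a)/2)². The resulting factor 2 in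
    -- the exponent is more than needed and is dropped below.
    have hexp : -ε ^ 2 / (2 * ((∑ _i : Fin T, (‖b - a‖₊ / 2) ^ 2 : NNReal) : ℝ)) =
        -2 * (Real.log G.card + Real.log (1 / δ)) := by
      have hT' : (0 : ℝ) < T := by exact_mod_cast hT
      have hba : 0 < b - a := by linarith
      rw [hε, mul_pow, Real.sq_sqrt (by positivity)]
      simp only [Finset.sum_const, Finset.card_univ, Fintype.card_fin, nsmul_eq_mul]
      push_cast
      rw [Real.norm_of_nonneg hba.le]
      field_simp
    rw [hexp]
    calc _ ≤ Real.exp (-(Real.log G.card + Real.log (1 / δ))) := by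
          apply Real.exp_le_exp.2; linarith
      _ = _ := by
        rw [Real.exp_neg, Real.exp_add, Real.exp_log (by linarith), Real.exp_log (by positivity)]
        field_simp
  have hsub : {p : Fin T → α | ∃ h ∈ G, ∑ t, ∑ k, (P t k).toReal * h t k + ε ≤ ∑ t, h t (p t)} =
      ⋃ h ∈ G, {p | ∑ t, ∑ k, (P t k).toReal * h t k + ε ≤ ∑ t, h t (p t)} := by
    ext p; simp
  rw [hsub]
  calc _ ≤ ∑ h ∈ G, μ.real {p | ∑ t, ∑ k, (P t k).toReal * h t k + ε ≤ ∑ t, h t (p t)} :=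
        measureReal_biUnion_finset_le _ _
    _ ≤ ∑ _h ∈ G, δ / G.card := Finset.sum_le_sum hone
    _ = δ := by rw [Finset.sum_const, nsmul_eq_mul]; field_simp

/-- A tail bound at level `δ` and an almost sure bound give a bound in expectation. -/
theorem integral_le_add_of_tail {Ω : Type*} [MeasurableSpace Ω] [Finite Ω]
    [MeasurableSingletonClass Ω] {μ : Measure Ω} [IsProbabilityMeasure μ] {f : Ω → ℝ}
    {R M δ : ℝ} (hM : ∀ ω, f ω ≤ M) (hM0 : 0 ≤ M) (hR : 0 ≤ R)
    (h : 1 - δ ≤ μ.real {ω | f ω ≤ R}) : ∫ ω, f ω ∂μ ≤ R + M * δ := by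
  have hms : MeasurableSet {ω | f ω ≤ R} := (Set.toFinite _).measurableSet
  -- Off the event f ≤ R, the bound M is used and R ≥ 0 is added for free.
  have hle : ∀ ω, f ω ≤ R + Set.indicator {ω | f ω ≤ R}ᶜ (fun _ => M) ω := fun ω => by
    by_cases hω : f ω ≤ R
    · simp [Set.indicator, hω]
    · have := hM ω
      simp only [Set.indicator, Set.mem_compl_iff, Set.mem_ofPred_eq, hω, not_false_eq_true, if_true]
      linarith
  calc ∫ ω, f ω ∂μ ≤ ∫ ω, R + Set.indicator {ω | f ω ≤ R}ᶜ (fun _ => M) ω ∂μ :=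
        integral_mono .of_finite .of_finite hle
    _ = R + M * μ.real {ω | f ω ≤ R}ᶜ := by
        rw [integral_add (integrable_const _) .of_finite, integral_const,
          integral_indicator_const _ hms.compl]
        simp [mul_comm]
    _ ≤ R + M * δ := by
        rw [probReal_compl_eq_one_sub hms]
        gcongr
        linarith

end Concentration

/-! ### Reasoning about programs -/

namespace RealRAM

@[simp] theorem Store.setReg_cell (s : Store) (v n : ℕ) : (s.setReg v n).cell = s.cell := rfl

theorem Store.setReg_reg (s : Store) (v n r : ℕ) :
    (s.setReg v n).reg r = if r = v then n else s.reg r := by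
  simp [Store.setReg, Function.update_apply]

@[simp] theorem Store.setCell_reg (s : Store) (a i j k : ℕ) (r : ℝ) :
    (s.setCell a i j k r).reg = s.reg := rfl

theorem Store.setCell_cell (s : Store) (a i j k : ℕ) (r : ℝ) (a' i' j' k' : ℕ) :
    (s.setCell a i j k r).cell a' i' j' k' =
      if a' = a ∧ i' = i ∧ j' = j ∧ k' = k then r else s.cell a' i' j' k' := rfl

/-- The index expression mentions only the registers `0, 1, 2`. -/
def IExp.Param : IExp → Prop
  | lit _ => True
  | reg v => v < 3
  | add e₁ e₂ => e₁.Param ∧ e₂.Param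
  | sub e₁ e₂ => e₁.Param ∧ e₂.Param

theorem IExp.Param.eval_congr {e : IExp} (he : e.Param) {s s' : Store}
    (h : ∀ v < 3, s'.reg v = s.reg v) : e.eval s' = e.eval s := by
  induction e with
  | lit n => rfl
  | reg v => exact h v he
  | add e₁ e₂ h₁ h₂ => simp only [IExp.eval, h₁ he.1, h₂ he.2]
  | sub e₁ e₂ h₁ h₂ => simp only [IExp.eval, h₁ he.1, h₂ he.2]

namespace Cmd

/-- The registers `0, 1, 2` are not written, and loop bounds depend only on them. -/
def Static : Cmd → Prop
  | setReg v _ => 3 ≤ v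
  | setCell _ _ _ _ _ => True
  | seq c₁ c₂ => c₁.Static ∧ c₂.Static
  | ifIndex _ _ c c' => c.Static ∧ c'.Static
  | ifReal _ _ c c' => c.Static ∧ c'.Static
  | loop v e c => 3 ≤ v ∧ e.Param ∧ c.Static

/-- A syntactic bound for the running time of a static command. -/
def cost (s : Store) : Cmd → ℕ
  | setReg _ e => e.size + 1
  | setCell _ i j k e => i.size + j.size + k.size + e.size + 1
  | seq c₁ c₂ => c₁.cost s + c₂.cost s
  | ifIndex e₁ e₂ c c' => e₁.size + e₂.size + 1 + (c.cost s + c'.cost s)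
  | ifReal e₁ e₂ c c' => e₁.size + e₂.size + 1 + (c.cost s + c'.cost s)
  | loop _ e c => e.size + 1 + e.eval s * (c.cost s + 1)

/-- The command does not write the register `r`. -/
def KeepsReg (r : ℕ) : Cmd → Prop
  | setReg v _ => r ≠ v
  | setCell _ _ _ _ _ => True
  | seq c₁ c₂ => c₁.KeepsReg r ∧ c₂.KeepsReg r
  | ifIndex _ _ c c' => c.KeepsReg r ∧ c'.KeepsReg r
  | ifReal _ _ c c' => c.KeepsReg r ∧ c'.KeepsReg r
  | loop v _ c => r ≠ v ∧ c.KeepsReg r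

/-- The command does not write the array `a`. -/
def KeepsArray (a : ℕ) : Cmd → Prop
  | setReg _ _ => True
  | setCell b _ _ _ _ => a ≠ b
  | seq c₁ c₂ => c₁.KeepsArray a ∧ c₂.KeepsArray a
  | ifIndex _ _ c c' => c.KeepsArray a ∧ c'.KeepsArray a
  | ifReal _ _ c c' => c.KeepsArray a ∧ c'.KeepsArray a
  | loop _ _ c => c.KeepsArray a

/-- The command writes the array `a` only in the row whose index is in the register `r`. -/
def RowOnly (r a : ℕ) : Cmd → Prop
  | setReg _ _ => True
  | setCell b i _ _ _ => a ≠ b ∨ i = .reg r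
  | seq c₁ c₂ => c₁.RowOnly r a ∧ c₂.RowOnly r a
  | ifIndex _ _ c c' => c.RowOnly r a ∧ c'.RowOnly r a
  | ifReal _ _ c c' => c.RowOnly r a ∧ c'.RowOnly r a
  | loop _ _ c => c.RowOnly r a

/-- The command writes the array `a` only at those entries whose second index is in the register
`r`. -/
def ColOnly (r a : ℕ) : Cmd → Prop
  | setReg _ _ => True
  | setCell b _ j _ _ => a ≠ b ∨ j = .reg r
  | seq c₁ c₂ => c₁.ColOnly r a ∧ c₂.ColOnly r a
  | ifIndex _ _ c c' => c.ColOnly r a ∧ c'.ColOnly r a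
  | ifReal _ _ c c' => c.ColOnly r a ∧ c'.ColOnly r a
  | loop _ _ c => c.ColOnly r a

theorem iter_induction {v : ℕ} {f : Store → Store} {s : Store} (I : ℕ → Store → Prop) {n : ℕ}
    (h0 : I 0 s) (hs : ∀ m < n, ∀ s', I m s' → I (m + 1) (f (s'.setReg v m))) :
    I n (iter v f s n) := by
  induction n with
  | zero => exact h0
  | succ n ih => exact hs n n.lt_succ_self _ (ih fun m hm => hs m (hm.trans n.lt_succ_self))

/-- Loops whose passes act on separate parts of the memory. -/
theorem iter_parallel {v : ℕ} {f : Store → Store} {s : Store} (J : Store → Prop)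
    (Pre Post : ℕ → Store → Prop) {n : ℕ} (hJ : J s) (hPre : ∀ m < n, Pre m s)
    (h : ∀ m < n, ∀ s, J s → Pre m s → J (f (s.setReg v m)) ∧ Post m (f (s.setReg v m)) ∧
      ∀ m' < n, m' ≠ m → (Pre m' s → Pre m' (f (s.setReg v m))) ∧
        (Post m' s → Post m' (f (s.setReg v m)))) :
    J (iter v f s n) ∧ ∀ m < n, Post m (iter v f s n) := by
  have key := iter_induction (v := v) (f := f) (s := s) (n := n)
    (fun m s => J s ∧ (∀ m' < m, m' < n → Post m' s) ∧ ∀ m' < n, m ≤ m' → Pre m' s)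
    ⟨hJ, by simp, fun m' hm' _ => hPre m' hm'⟩ (by
      rintro m hm s' ⟨hJ, hpost, hpre⟩
      obtain ⟨h1, h2, h3⟩ := h m hm s' hJ (hpre m hm le_rfl)
      refine ⟨h1, fun m' hm' hn => ?_, fun m' hn hm' => ?_⟩
      · rcases Nat.lt_succ_iff_lt_or_eq.1 hm' with h4 | rfl
        · exact (h3 m' hn h4.ne).2 (hpost m' h4 hn)
        · exact h2
      · exact (h3 m' hn (by omega)).1 (hpre m' hn (by omega)))
  exact ⟨key.1, fun m hm => key.2.1 m hm hm⟩

theorem KeepsReg.exec {r : ℕ} {c : Cmd} (hc : c.KeepsReg r) (s : Store) :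
    (c.exec s).reg r = s.reg r := by
  induction c generalizing s with
  | setReg v e => simp only [Cmd.exec, Store.setReg_reg, if_neg hc]
  | setCell a i j k e => rfl
  | seq c₁ c₂ h₁ h₂ => rw [Cmd.exec, h₂ hc.2, h₁ hc.1]
  | ifIndex e₁ e₂ c c' h h' => rw [Cmd.exec]; split_ifs; exacts [h hc.1 s, h' hc.2 s]
  | ifReal e₁ e₂ c c' h h' => rw [Cmd.exec]; split_ifs; exacts [h hc.1 s, h' hc.2 s]
  | loop v e c h =>
    exact iter_induction (fun _ s' => s'.reg r = s.reg r) rfl fun m _ s' hs' => by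
      rw [h hc.2, Store.setReg_reg, if_neg hc.1, hs']

theorem KeepsArray.exec {a : ℕ} {c : Cmd} (hc : c.KeepsArray a) (s : Store) :
    (c.exec s).cell a = s.cell a := by
  induction c generalizing s with
  | setReg v e => rfl
  | setCell b i j k e =>
    funext i' j' k'
    exact if_neg fun h => hc h.1
  | seq c₁ c₂ h₁ h₂ => rw [Cmd.exec, h₂ hc.2, h₁ hc.1]
  | ifIndex e₁ e₂ c c' h h' => rw [Cmd.exec]; split_ifs; exacts [h hc.1 s, h' hc.2 s]
  | ifReal e₁ e₂ c c' h h' => rw [Cmd.exec]; split_ifs; exacts [h hc.1 s, h' hc.2 s]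
  | loop v e c h =>
    exact iter_induction (fun _ s' => s'.cell a = s.cell a) rfl fun m _ s' hs' => by
      rw [h hc, Store.setReg_cell, hs']

theorem RowOnly.exec {r a : ℕ} {c : Cmd} (hc : c.RowOnly r a) (hr : c.KeepsReg r) (s : Store)
    {m : ℕ} (hm : m ≠ s.reg r) : (c.exec s).cell a m = s.cell a m := by
  induction c generalizing s with
  | setReg v e => rfl
  | setCell b i j k e =>
    funext j' k'
    refine if_neg fun h => ?_
    rcases hc with h' | h'
    · exact h' h.1
    · subst h'; exact hm h.2.1
  | seq c₁ c₂ h₁ h₂ =>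
    rw [Cmd.exec, h₂ hc.2 hr.2 _ (by rwa [hr.1.exec]), h₁ hc.1 hr.1 _ hm]
  | ifIndex e₁ e₂ c c' h h' =>
    rw [Cmd.exec]; split_ifs; exacts [h hc.1 hr.1 s hm, h' hc.2 hr.2 s hm]
  | ifReal e₁ e₂ c c' h h' =>
    rw [Cmd.exec]; split_ifs; exacts [h hc.1 hr.1 s hm, h' hc.2 hr.2 s hm]
  | loop v e c h =>
    refine (iter_induction (fun _ s' => s'.reg r = s.reg r ∧ s'.cell a m = s.cell a m) ⟨rfl, rfl⟩
      fun m' _ s' hs' => ?_).2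
    have h1 : (s'.setReg v m').reg r = s.reg r := by
      rw [Store.setReg_reg, if_neg hr.1, hs'.1]
    exact ⟨by rw [hr.2.exec, h1], by rw [h hc hr.2 _ (by rwa [h1]), Store.setReg_cell, hs'.2]⟩

theorem ColOnly.exec {r a : ℕ} {c : Cmd} (hc : c.ColOnly r a) (hr : c.KeepsReg r) (s : Store)
    {m : ℕ} (hm : m ≠ s.reg r) (i : ℕ) : (c.exec s).cell a i m = s.cell a i m := by
  induction c generalizing s with
  | setReg v e => rfl
  | setCell b i j k e =>
    funext k'
    refine if_neg fun h => ?_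
    rcases hc with h' | h'
    · exact h' h.1
    · subst h'; exact hm h.2.2.1
  | seq c₁ c₂ h₁ h₂ =>
    rw [Cmd.exec, h₂ hc.2 hr.2 _ (by rwa [hr.1.exec]), h₁ hc.1 hr.1 _ hm]
  | ifIndex e₁ e₂ c c' h h' =>
    rw [Cmd.exec]; split_ifs; exacts [h hc.1 hr.1 s hm, h' hc.2 hr.2 s hm]
  | ifReal e₁ e₂ c c' h h' =>
    rw [Cmd.exec]; split_ifs; exacts [h hc.1 hr.1 s hm, h' hc.2 hr.2 s hm]
  | loop v e c h =>
    refine (iter_induction (fun _ s' => s'.reg r = s.reg r ∧ s'.cell a i m = s.cell a i m)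
      ⟨rfl, rfl⟩ fun m' _ s' hs' => ?_).2
    have h1 : (s'.setReg v m').reg r = s.reg r := by
      rw [Store.setReg_reg, if_neg hr.1, hs'.1]
    exact ⟨by rw [hr.2.exec, h1], by rw [h hc hr.2 _ (by rwa [h1]), Store.setReg_cell, hs'.2]⟩

theorem Static.keepsReg {c : Cmd} (hc : c.Static) {v : ℕ} (hv : v < 3) : c.KeepsReg v := by
  induction c with
  | setReg w e => exact (hv.trans_le hc).ne
  | setCell b i j k e => trivial
  | seq c₁ c₂ h₁ h₂ => exact ⟨h₁ hc.1, h₂ hc.2⟩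
  | ifIndex e₁ e₂ c c' h h' => exact ⟨h hc.1, h' hc.2⟩
  | ifReal e₁ e₂ c c' h h' => exact ⟨h hc.1, h' hc.2⟩
  | loop w e c h => exact ⟨(hv.trans_le hc.1).ne, h hc.2.2⟩

/-- Loop bounds read only registers that are never written, so a loop has the same bound each time
it is reached, namely the one computed in `s₀`. A branch is charged for both alternatives. -/
theorem Static.time_le_cost {c : Cmd} (hc : c.Static) {s₀ s : Store}
    (hs : ∀ v < 3, s.reg v = s₀.reg v) : c.time s ≤ c.cost s₀ := by
  induction c generalizing s with
  | setReg w e => exact le_rfl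
  | setCell b i j k e => exact le_rfl
  | seq c₁ c₂ h₁ h₂ =>
    exact add_le_add (h₁ hc.1 hs) (h₂ hc.2 fun v hv => by
      rw [(hc.1.keepsReg hv).exec, hs v hv])
  | ifIndex e₁ e₂ c c' h h' =>
    simp only [Cmd.time, Cmd.cost]
    have := h hc.1 hs
    have := h' hc.2 hs
    split_ifs <;> omega
  | ifReal e₁ e₂ c c' h h' =>
    simp only [Cmd.time, Cmd.cost]
    have := h hc.1 hs
    have := h' hc.2 hs
    split_ifs <;> omega
  | loop w e c h =>
    simp only [Cmd.time, Cmd.cost]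
    rw [hc.2.1.eval_congr hs]
    refine Nat.add_le_add_left ?_ _
    rw [← smul_eq_mul, ← Finset.card_range (e.eval s₀), ← Finset.sum_const, Finset.card_range]
    refine Finset.sum_le_sum fun m _ => Nat.add_le_add_right (h hc.2.2 fun v hv => ?_) 1
    have hne : v ≠ w := (hv.trans_le hc.1).ne
    rw [Store.setReg_reg, if_neg hne]
    refine iter_induction (fun _ s' => s'.reg v = s₀.reg v) (hs v hv) fun m' _ s' hs' => ?_
    rw [(hc.2.2.keepsReg hv).exec, Store.setReg_reg, if_neg hne, hs']

/-- `entry (a, i, 0, 0) := ∑ v < e, R`. -/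
def sumInto (a : ℕ) (i : IExp) (v : ℕ) (e : IExp) (R : RExp) : Cmd :=
  seq (setCell a i (.lit 0) (.lit 0) (.lit 0))
    (loop v e (setCell a i (.lit 0) (.lit 0) (.add (.cell a i (.lit 0) (.lit 0)) R)))

/-- The summand need only be evaluated in stores that differ from the initial one in the loop
counter and in the accumulator array; thus the running sum cannot feed back into the terms. -/
theorem sumInto_exec {a : ℕ} {i : IExp} {v : ℕ} {e : IExp} {R : RExp} {s : Store} {n m : ℕ}
    (F : ℕ → ℝ) (hi : ∀ s' : Store, (∀ r ≠ v, s'.reg r = s.reg r) → i.eval s' = m)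
    (hi0 : i.eval s = m) (he : ∀ s' : Store, s'.reg = s.reg → e.eval s' = n)
    (hR : ∀ (s' : Store) (l : ℕ), l < n → (∀ r ≠ v, s'.reg r = s.reg r) → s'.reg v = l →
      (∀ a' ≠ a, s'.cell a' = s.cell a') → R.eval s' = F l) :
    ((sumInto a i v e R).exec s).cell a m 0 0 = ∑ l ∈ Finset.range n, F l := by
  simp only [sumInto, Cmd.exec]
  rw [he (s.setCell _ _ _ _ _) rfl]
  refine (iter_induction (fun l s' => (∀ r ≠ v, s'.reg r = s.reg r) ∧
    (∀ a' ≠ a, s'.cell a' = s.cell a') ∧ s'.cell a m 0 0 = ∑ l ∈ Finset.range l, F l)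
    ?_ fun l hl s' hs' => ?_).2.2
  · refine ⟨fun _ _ => rfl, fun a' ha' => ?_, ?_⟩
    · funext x y z
      exact if_neg fun h => ha' h.1
    · simp [Store.setCell_cell, hi0, IExp.eval, RExp.eval]
  · obtain ⟨h1, h2, h3⟩ := hs'
    have h1' : ∀ r ≠ v, (s'.setReg v l).reg r = s.reg r := fun r hr => by
      rw [Store.setReg_reg, if_neg hr, h1 r hr]
    refine ⟨h1', fun a' ha' => ?_, ?_⟩
    · rw [← h2 a' ha']
      funext x y z
      exact if_neg fun h => ha' h.1
    · simp only [Store.setCell_cell, IExp.eval, RExp.eval, hi _ h1', and_self, if_true,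
        Store.setReg_cell, h3, Finset.sum_range_succ]
      rw [hR _ l hl h1' (by simp [Store.setReg_reg]) h2]

end Cmd

end RealRAM

/-! ### The forecasting program

Arrays: `3` and `4` hold, for every grid point, the inverse regularized Gram matrix and the ridge
estimate; `7` and `5` the linear predictions and their truncations to `[0, 1]`; `2` the forecast;
`6`, `8` and `9` are auxiliary. -/

namespace Forecaster

open RealRAM RealRAM.Cmd

/-- The entry `(i, 0, 0)` of the array `a`. -/
abbrev entry (a : ℕ) (i : IExp) : RExp := .cell a i (.lit 0) (.lit 0)

/-- `entry (a, i, 0, 0) := e`. -/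
abbrev setEntry (a : ℕ) (i : IExp) (e : RExp) : Cmd := .setCell a i (.lit 0) (.lit 0) e

def initCmd : Cmd :=
  loop 3 (.add (.reg 2) (.lit 1))
    (loop 4 (.reg 0) (setCell 3 (.reg 3) (.reg 4) (.reg 4) (.lit 1)))

/-- The forecast array is cleared here because memory survives between rounds and `twoPointForecast`
writes at most two of its entries. The raw predictions are kept besides the truncated ones, since
the regression update needs the raw residual. -/
def linearPredictions : Cmd :=
  loop 3 (.add (.reg 2) (.lit 1))
    (seq (setEntry 2 (.reg 3) (.lit 0))
    (seq (sumInto 7 (.reg 3) 4 (.reg 0)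
      (.mul (.cell 4 (.reg 3) (.reg 4) (.lit 0)) (entry 0 (.reg 4))))
    (ifReal (entry 7 (.reg 3)) (.lit 0) (setEntry 5 (.reg 3) (.lit 0))
      (ifReal (.lit 1) (entry 7 (.reg 3)) (setEntry 5 (.reg 3) (.lit 1))
        (setEntry 5 (.reg 3) (entry 7 (.reg 3)))))))

/-- Puts into register `6` the largest `k < N` with `k ≤ N q_k`. -/
def selectCrossing : Cmd :=
  seq (setReg 6 (.lit 0))
    (loop 3 (.reg 2)
      (ifReal (.ofIndex (.reg 3)) (.mul (entry 5 (.reg 3)) (.ofIndex (.reg 2)))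
        -- There is no idle command; copying register 6 to itself plays that role.
        (setReg 6 (.reg 3)) (setReg 6 (.reg 6))))

/-- The auxiliary entries are the gaps a = q_κ - κ/N and b = (κ+1)/N - q_{κ+1}, both nonnegative
after `selectCrossing`. The test a + b ≤ 0 thus detects a = b = 0, where the weights b/(a+b) and
a/(a+b) make no sense and κ/N is already exact. -/
def twoPointForecast : Cmd :=
  seq (setEntry 9 (.lit 0) (.sub (entry 5 (.reg 6)) (.div (.ofIndex (.reg 6)) (.ofIndex (.reg 2)))))
  (seq (setEntry 9 (.lit 1) (.sub
    (.div (.ofIndex (.add (.reg 6) (.lit 1))) (.ofIndex (.reg 2)))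
    (entry 5 (.add (.reg 6) (.lit 1)))))
  (ifReal (.add (entry 9 (.lit 0)) (entry 9 (.lit 1))) (.lit 0) (setEntry 2 (.reg 6) (.lit 1))
    (seq
      (setEntry 2 (.reg 6)
        (.div (entry 9 (.lit 1)) (.add (entry 9 (.lit 0)) (entry 9 (.lit 1)))))
      (setEntry 2 (.add (.reg 6) (.lit 1))
        (.div (entry 9 (.lit 0)) (.add (entry 9 (.lit 0)) (entry 9 (.lit 1))))))))

def predictCmd : Cmd := seq linearPredictions (seq selectCrossing twoPointForecast)

def updateRow : Cmd :=
  seq (setCell 4 (.reg 3) (.reg 4) (.lit 0)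
    (.add (.cell 4 (.reg 3) (.reg 4) (.lit 0))
      (.mul (.mul (entry 9 (.lit 0)) (.sub (entry 1 (.lit 0)) (entry 7 (.reg 3))))
        (entry 6 (.reg 4)))))
  (loop 5 (.reg 0) (setCell 3 (.reg 3) (.reg 4) (.reg 5)
    (.sub (.cell 3 (.reg 3) (.reg 4) (.reg 5))
      (.mul (entry 9 (.lit 0)) (.mul (entry 6 (.reg 4)) (entry 6 (.reg 5)))))))

/-- The vector Bx, the number xᵀBx and the gain are stored before B is touched, so the in-place
rank-one update uses only old values. -/
def updateRegression : Cmd :=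
  seq (loop 4 (.reg 0) (sumInto 6 (.reg 4) 5 (.reg 0)
    (.mul (.cell 3 (.reg 3) (.reg 4) (.reg 5)) (entry 0 (.reg 5)))))
  (seq (sumInto 8 (.lit 0) 4 (.reg 0) (.mul (entry 0 (.reg 4)) (entry 6 (.reg 4))))
  (seq (setEntry 9 (.lit 0) (.div (entry 2 (.reg 3))
    (.add (.lit 1) (.mul (entry 2 (.reg 3)) (entry 8 (.lit 0))))))
  (loop 4 (.reg 0) updateRow)))

def updateCmd : Cmd := loop 3 (.add (.reg 2) (.lit 1)) updateRegression

def program : OnlineProgram := ⟨initCmd, predictCmd, updateCmd⟩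

/-! ### Effect of the commands on the memory -/

theorem initCmd_static : initCmd.Static := by
  simp [initCmd, Static, IExp.Param]

theorem predictCmd_static : predictCmd.Static := by
  simp [predictCmd, linearPredictions, selectCrossing, twoPointForecast, sumInto, Static,
    IExp.Param]

theorem updateCmd_static : updateCmd.Static := by
  simp [updateCmd, updateRegression, updateRow, sumInto, Static, IExp.Param]

theorem initCmd_exec (s : Store) (hs : ∀ k i j, s.cell 3 k i j = 0) :
    (∀ k < s.reg 2 + 1, ∀ i < s.reg 0, ∀ j, (initCmd.exec s).cell 3 k i j = if i = j then 1 else 0)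
      := by
  have hbody : ∀ s' : Store, (∀ k i j, i ≠ j → s'.cell 3 k i j = 0) →
      let s'' := Cmd.exec (loop 4 (.reg 0) (setCell 3 (.reg 3) (.reg 4) (.reg 4) (.lit 1))) s'
      (∀ k i j, i ≠ j → s''.cell 3 k i j = 0) ∧
        ∀ i < s'.reg 0, s''.cell 3 (s'.reg 3) i i = 1 := by
    intro s' h0
    have := iter_parallel (v := 4)
      (f := Cmd.exec (setCell 3 (.reg 3) (.reg 4) (.reg 4) (.lit 1))) (s := s')
      (fun t => (∀ k i j, i ≠ j → t.cell 3 k i j = 0) ∧ t.reg 3 = s'.reg 3)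
      (fun _ _ => True) (fun i t => t.cell 3 (s'.reg 3) i i = 1) (n := s'.reg 0)
      ⟨h0, rfl⟩ (by simp) (by
        rintro m hm t ⟨ht, ht3⟩ -
        refine ⟨⟨fun k i j hij => ?_, ?_⟩, ?_, fun m' _ hm' => ⟨fun h => h, fun h => ?_⟩⟩
        · simp only [Cmd.exec, Store.setCell_cell, IExp.eval, Store.setReg_reg, if_true]
          rw [if_neg (by rintro ⟨-, -, rfl, rfl⟩; exact hij rfl)]
          exact ht k i j hij
        · simp [Cmd.exec, Store.setReg_reg, ht3]
        · simp [Cmd.exec, Store.setCell_cell, Store.setReg_reg, IExp.eval, RExp.eval, ht3]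
        · simp only [Cmd.exec, Store.setCell_cell, IExp.eval, Store.setReg_reg, if_true]
          rw [if_neg (by rintro ⟨-, -, h1, -⟩; exact hm' h1)]
          exact h)
    exact ⟨this.1.1, this.2⟩
  set c := loop 4 (.reg 0) (setCell 3 (.reg 3) (.reg 4) (.reg 4) (.lit 1)) with hc
  have hrow : c.RowOnly 3 3 := by simp [hc, RowOnly]
  have hk3 : c.KeepsReg 3 := by simp [hc, KeepsReg]
  have hk0 : c.KeepsReg 0 := by simp [hc, KeepsReg]
  have := iter_parallel (v := 3) (f := c.exec) (s := s)
    (fun t => (∀ k i j, i ≠ j → t.cell 3 k i j = 0) ∧ t.reg 0 = s.reg 0)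
    (fun _ _ => True) (fun k t => ∀ i < s.reg 0, t.cell 3 k i i = 1) (n := s.reg 2 + 1)
    ⟨fun k i j _ => hs k i j, rfl⟩ (by simp) (by
      rintro m hm t ⟨ht, ht0⟩ -
      have h := hbody (t.setReg 3 m) ht
      simp only [Store.setReg_reg, if_true, show (0 : ℕ) ≠ 3 by decide, if_false, ht0] at h
      refine ⟨⟨h.1, ?_⟩, h.2, fun m' _ hm' => ⟨fun h => h, fun h' => ?_⟩⟩
      · rw [hk0.exec, Store.setReg_reg, if_neg (by decide), ht0]
      · rw [hrow.exec hk3 _ (by simpa [Store.setReg_reg] using hm')]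
        exact h')
  intro k hk i hi j
  change (iter 3 c.exec s (s.reg 2 + 1)).cell 3 k i j = _
  split_ifs with hij
  · subst hij; exact this.2 k hk i hi
  · exact this.1.1 k i j hij

/-- Truncation to `[0, 1]`. -/
def clip (m : ℝ) : ℝ := max 0 (min 1 m)

theorem linearPredictions_exec (s : Store) :
    let s' := linearPredictions.exec s
    (∀ k < s.reg 2 + 1, s'.cell 7 k 0 0 =
      ∑ i ∈ Finset.range (s.reg 0), s.cell 4 k i 0 * s.cell 0 i 0 0) ∧
    (∀ k < s.reg 2 + 1, s'.cell 5 k 0 0 = clip (s'.cell 7 k 0 0)) ∧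
    ∀ k < s.reg 2 + 1, s'.cell 2 k 0 0 = 0 := by
  intro s'
  obtain ⟨c, hc⟩ : ∃ c, linearPredictions = loop 3 (.add (.reg 2) (.lit 1)) c := ⟨_, rfl⟩
  obtain ⟨c₁, c₂, c₃, hc'⟩ : ∃ c₁ c₂ c₃, c = seq c₁ (seq c₂ c₃) := by
    simp only [linearPredictions, loop.injEq, true_and] at hc
    exact ⟨_, _, _, hc.symm⟩
  obtain ⟨h1, h2, h3⟩ : c₁ = setEntry 2 (.reg 3) (.lit 0) ∧
      c₂ = sumInto 7 (.reg 3) 4 (.reg 0)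
        (.mul (.cell 4 (.reg 3) (.reg 4) (.lit 0)) (entry 0 (.reg 4))) ∧
      c₃ = (ifReal (entry 7 (.reg 3)) (.lit 0) (setEntry 5 (.reg 3) (.lit 0))
        (ifReal (.lit 1) (entry 7 (.reg 3)) (setEntry 5 (.reg 3) (.lit 1))
          (setEntry 5 (.reg 3) (entry 7 (.reg 3))))) := by
    simp only [linearPredictions, loop.injEq, true_and, hc', seq.injEq] at hc
    exact ⟨hc.1.symm, hc.2.1.symm, hc.2.2.symm⟩
  have hrow : ∀ a ∈ ({2, 5, 7} : Finset ℕ), c.RowOnly 3 a := by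
    simp [hc', h1, h2, h3, RowOnly, sumInto]
  have hreg : ∀ r ∈ ({0, 3} : Finset ℕ), c.KeepsReg r := by
    simp [hc', h1, h2, h3, KeepsReg, sumInto]
  have harr : ∀ a ∈ ({0, 4} : Finset ℕ), c.KeepsArray a := by
    simp [hc', h1, h2, h3, KeepsArray, sumInto]
  have key := iter_parallel (v := 3) (f := c.exec) (s := s)
    (fun t => t.cell 0 = s.cell 0 ∧ t.cell 4 = s.cell 4 ∧ t.reg 0 = s.reg 0)
    (fun _ _ => True)
    (fun k t => t.cell 7 k 0 0 = ∑ i ∈ Finset.range (s.reg 0), s.cell 4 k i 0 * s.cell 0 i 0 0 ∧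
      t.cell 5 k 0 0 = clip (t.cell 7 k 0 0) ∧ t.cell 2 k 0 0 = 0) (n := s.reg 2 + 1)
    ⟨rfl, rfl, rfl⟩ (by simp) (by
      rintro m hm t ⟨ht0, ht4, htr⟩ -
      set u := t.setReg 3 m with hu
      have hu3 : u.reg 3 = m := by simp [hu, Store.setReg_reg]
      have hu0 : u.reg 0 = s.reg 0 := by simp [hu, Store.setReg_reg, htr]
      refine ⟨⟨?_, ?_, ?_⟩, ?_, fun m' _ hm' => ⟨fun h => h, fun h => ?_⟩⟩
      · rw [(harr 0 (by simp)).exec]; exact ht0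
      · rw [(harr 4 (by simp)).exec]; exact ht4
      · rw [(hreg 0 (by simp)).exec, hu0]
      · have e7 : (c₂.exec (c₁.exec u)).cell 7 m 0 0 =
            ∑ i ∈ Finset.range (s.reg 0), s.cell 4 m i 0 * s.cell 0 i 0 0 := by
          rw [h2]
          have hr : (c₁.exec u).reg = u.reg := by rw [h1]; rfl
          have ha : ∀ a, a ≠ 2 → (c₁.exec u).cell a = t.cell a := fun a ha => by
            rw [KeepsArray.exec (by rw [h1]; exact ha)]; rfl
          refine sumInto_exec _ (fun s' hs' => ?_) ?_ (fun s' hs' => ?_) (fun s' l hl hs' hl' ha' => ?_)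
          · simp [IExp.eval, hs' 3 (by decide), hr, hu3]
          · simp [IExp.eval, hr, hu3]
          · simp [IExp.eval, hs', hr, hu0]
          · simp [RExp.eval, IExp.eval, hs' 3 (by decide), hr, hu3, hl', ha', ha, ht0, ht4]
        have e3 : (c₂.exec (c₁.exec u)).reg 3 = m := by
          rw [KeepsReg.exec (by rw [h2]; simp [sumInto, KeepsReg]),
            KeepsReg.exec (by rw [h1]; simp [KeepsReg]), hu3]
        have e2 : (c₂.exec (c₁.exec u)).cell 2 m 0 0 = 0 := by
          rw [KeepsArray.exec (by rw [h2]; simp [sumInto, KeepsArray]), h1]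
          simp [Cmd.exec, Store.setCell_cell, IExp.eval, RExp.eval, hu3]
        have k7 : (c.exec u).cell 7 = (c₂.exec (c₁.exec u)).cell 7 := by
          rw [hc', Cmd.exec, Cmd.exec, KeepsArray.exec (by rw [h3]; simp [KeepsArray])]
        have k2 : (c.exec u).cell 2 = (c₂.exec (c₁.exec u)).cell 2 := by
          rw [hc', Cmd.exec, Cmd.exec, KeepsArray.exec (by rw [h3]; simp [KeepsArray])]
        refine ⟨by rw [k7, e7], ?_, by rw [k2, e2]⟩
        rw [k7, hc', Cmd.exec, Cmd.exec]
        set z := c₂.exec (c₁.exec u)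
        rw [h3]
        simp only [Cmd.exec, RExp.eval, IExp.eval, e3, clip]
        split_ifs with g1 g2
        · simp only [Rat.cast_zero] at g1
          simp [Store.setCell_cell, g1]
        · simp only [Rat.cast_one] at g2
          simp [Store.setCell_cell, g2]
        · simp only [Rat.cast_zero, Rat.cast_one, not_le] at g1 g2
          simp [Store.setCell_cell, g1.le, g2.le]
      · have hne : m' ≠ u.reg 3 := by rwa [hu3]
        simp only [(hrow 2 (by simp)).exec (hreg 3 (by simp)) u hne,
          (hrow 5 (by simp)).exec (hreg 3 (by simp)) u hne,
          (hrow 7 (by simp)).exec (hreg 3 (by simp)) u hne]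
        exact h)
  have hs' : s' = iter 3 c.exec s (s.reg 2 + 1) := by
    simp only [s', hc]; rfl
  rw [hs']
  exact ⟨fun k hk => (key.2 k hk).1, fun k hk => (key.2 k hk).2.1, fun k hk => (key.2 k hk).2.2⟩

/-- The start value 0 is a legitimate candidate because q_0 ≥ 0. The search stops before N, so that
κ + 1 is still a grid index. -/
theorem selectCrossing_exec (s : Store) (hN : 0 < s.reg 2) (hq : 0 ≤ s.cell 5 0 0 0) :
    let s' := selectCrossing.exec s
    s'.reg 6 < s.reg 2 ∧ (s'.reg 6 : ℝ) ≤ s.cell 5 (s'.reg 6) 0 0 * s.reg 2 ∧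
      ∀ j < s.reg 2, s'.reg 6 < j → s.cell 5 j 0 0 * s.reg 2 < j := by
  intro s'
  have key := iter_induction (v := 3)
    (f := Cmd.exec (ifReal (.ofIndex (.reg 3)) (.mul (entry 5 (.reg 3)) (.ofIndex (.reg 2)))
        (setReg 6 (.reg 3)) (setReg 6 (.reg 6)))) (s := s.setReg 6 0) (n := s.reg 2)
    (fun m t => t.cell = s.cell ∧ t.reg 2 = s.reg 2 ∧ t.reg 6 < s.reg 2 ∧
      (t.reg 6 : ℝ) ≤ s.cell 5 (t.reg 6) 0 0 * s.reg 2 ∧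
      ∀ j < m, t.reg 6 < j → s.cell 5 j 0 0 * s.reg 2 < j)
    ⟨rfl, by simp [Store.setReg_reg], by simpa [Store.setReg_reg] using hN, by
      simp only [Store.setReg_reg, if_true]; push_cast; positivity, by simp⟩ (by
    rintro m hm t ⟨h1, h2, h3, h4, h5⟩
    simp only [Cmd.exec, RExp.eval, IExp.eval, Store.setReg_reg, Store.setReg_cell, if_true, h1,
      show (2 : ℕ) ≠ 3 by decide, show (6 : ℕ) ≠ 3 by decide, if_false, h2]
    split_ifs with h
    · refine ⟨h1, by simp [Store.setReg_reg, h2], ?_, ?_, ?_⟩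
      · simpa [Store.setReg_reg] using hm
      · simpa [Store.setReg_reg] using h
      · intro j hj hj'
        simp only [Store.setReg_reg, if_true] at hj'
        omega
    · refine ⟨h1, by simp [Store.setReg_reg, h2], ?_, ?_, ?_⟩
      · simpa [Store.setReg_reg] using h3
      · simpa [Store.setReg_reg] using h4
      · intro j hj hj'
        simp only [Store.setReg_reg, if_true] at hj'
        rcases Nat.lt_succ_iff_lt_or_eq.1 hj with h6 | rfl
        · exact h5 j h6 hj'
        · exact not_le.1 h)
  have hs' : s' = iter 3 (Cmd.exec (ifReal (.ofIndex (.reg 3))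
      (.mul (entry 5 (.reg 3)) (.ofIndex (.reg 2)))
        (setReg 6 (.reg 3)) (setReg 6 (.reg 6)))) (s.setReg 6 0) (s.reg 2) := by
    simp only [s', selectCrossing, Cmd.exec, IExp.eval, Store.setReg_reg,
      show (2 : ℕ) ≠ 6 by decide, if_false]
  rw [hs']
  exact key.2.2

theorem clip_nonneg (m : ℝ) : 0 ≤ clip m := le_max_left _ _

theorem clip_le_one (m : ℝ) : clip m ≤ 1 := max_le zero_le_one (min_le_left _ _)

theorem sq_clip_sub_le_one (m : ℝ) {y : ℝ} (hy : y = 0 ∨ y = 1) : (clip m - y) ^ 2 ≤ 1 := by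
  have h0 := clip_nonneg m
  have h1 := clip_le_one m
  rcases hy with rfl | rfl <;> nlinarith

theorem sq_clip_sub_le (m : ℝ) {y : ℝ} (hy : y = 0 ∨ y = 1) :
    (clip m - y) ^ 2 ≤ (m - y) ^ 2 := by
  rw [sq_le_sq]
  have hy' : clip y = y := by rcases hy with rfl | rfl <;> simp [clip]
  calc |clip m - y| = |clip m - clip y| := by rw [hy']
    _ ≤ |min 1 m - min 1 y| := by
      simpa [clip, max_comm] using abs_max_sub_max_le_abs (min 1 m) (min 1 y) 0
    _ ≤ |m - y| := by simpa [min_comm] using abs_min_sub_min_le_max m 1 y 1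

theorem twoPointForecast_cell (s : Store) :
    let s' := twoPointForecast.exec s
    let κ := s.reg 6
    let a := s.cell 5 κ 0 0 - (κ : ℝ) / s.reg 2
    let b := ((κ + 1 : ℕ) : ℝ) / s.reg 2 - s.cell 5 (κ + 1) 0 0
    ∀ k, s'.cell 2 k 0 0 = if a + b ≤ 0 then (if k = κ then 1 else s.cell 2 k 0 0) else
      if k = κ then b / (a + b) else if k = κ + 1 then a / (a + b) else s.cell 2 k 0 0 := by
  intro s' κ a b k
  set u := (s.setCell 9 0 0 0 a).setCell 9 1 0 0 b with hu
  have h0 : u.cell 9 0 0 0 = a := by simp [hu, Store.setCell_cell]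
  have h1 : u.cell 9 1 0 0 = b := by simp [hu, Store.setCell_cell]
  have h2 : ∀ k, u.cell 2 k 0 0 = s.cell 2 k 0 0 := fun k => by simp [hu, Store.setCell_cell]
  have hs' : s' = Cmd.exec (ifReal (.add (entry 9 (.lit 0)) (entry 9 (.lit 1))) (.lit 0)
      (setEntry 2 (.reg 6) (.lit 1))
      (seq
        (setEntry 2 (.reg 6)
          (.div (entry 9 (.lit 1)) (.add (entry 9 (.lit 0)) (entry 9 (.lit 1)))))
        (setEntry 2 (.add (.reg 6) (.lit 1))
          (.div (entry 9 (.lit 0)) (.add (entry 9 (.lit 0)) (entry 9 (.lit 1))))))) u := by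
    simp only [s', twoPointForecast, Cmd.exec, RExp.eval, IExp.eval, Store.setCell_cell,
      Store.setCell_reg, show (5 : ℕ) ≠ 9 by decide, false_and, if_false]
    rfl
  have h6 : u.reg 6 = κ := rfl
  rw [hs']
  simp only [Cmd.exec, RExp.eval, IExp.eval, h0, h1, h6, Rat.cast_zero]
  split_ifs with g1 g2 g3 g4
  · simp [Store.setCell_cell, g2]
  · simp [Store.setCell_cell, g2, h2]
  · simp [Store.setCell_cell, g3, h6]
  · simp [Store.setCell_cell, g4, h6, h0, h1]
  · simp [Store.setCell_cell, g4, g3, h6, h2]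

theorem twoPointForecast_exec (s : Store) (hκ : s.reg 6 < s.reg 2)
    (hκ' : (s.reg 6 : ℝ) ≤ s.cell 5 (s.reg 6) 0 0 * s.reg 2)
    (hq : s.cell 5 (s.reg 6 + 1) 0 0 * s.reg 2 ≤ (s.reg 6 + 1 : ℕ))
    (h0 : ∀ k < s.reg 2 + 1, s.cell 2 k 0 0 = 0) :
    let s' := twoPointForecast.exec s
    (∀ k < s.reg 2 + 1, 0 ≤ s'.cell 2 k 0 0) ∧
    ∑ k ∈ Finset.range (s.reg 2 + 1), s'.cell 2 k 0 0 = 1 ∧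
    ∀ y : ℝ, ∑ k ∈ Finset.range (s.reg 2 + 1),
      s'.cell 2 k 0 0 * (((k : ℝ) / s.reg 2 - y) ^ 2 - (s.cell 5 k 0 0 - y) ^ 2) ≤
        1 / (4 * (s.reg 2 : ℝ) ^ 2) := by
  intro s'
  have hcell := twoPointForecast_cell s
  simp only at hcell
  set κ := s.reg 6 with hκdef
  set N := s.reg 2 with hN
  have hN0 : (0 : ℝ) < N := by exact_mod_cast (Nat.zero_le κ).trans_lt hκ
  set a := s.cell 5 κ 0 0 - (κ : ℝ) / N with ha
  set b := ((κ + 1 : ℕ) : ℝ) / N - s.cell 5 (κ + 1) 0 0 with hb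
  have ha0 : 0 ≤ a := by rw [ha, sub_nonneg, div_le_iff₀ hN0]; exact hκ'
  have hb0 : 0 ≤ b := by rw [hb, sub_nonneg, le_div_iff₀ hN0]; exact hq
  obtain ⟨α, β, hα, hβ, hαβ, hk, hy⟩ : ∃ α β : ℝ, 0 ≤ α ∧ 0 ≤ β ∧ α + β = 1 ∧
      (∀ k < N + 1, s'.cell 2 k 0 0 = (if k = κ then α else 0) + if k = κ + 1 then β else 0) ∧
      ∀ y : ℝ, α * (((κ : ℝ) / N - y) ^ 2 - (s.cell 5 κ 0 0 - y) ^ 2) +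
        β * ((((κ + 1 : ℕ) : ℝ) / N - y) ^ 2 - (s.cell 5 (κ + 1) 0 0 - y) ^ 2) ≤
          1 / (4 * (N : ℝ) ^ 2) := by
    rcases le_or_gt (a + b) 0 with h | h
    · refine ⟨1, 0, zero_le_one, le_rfl, by simp, fun k hk => ?_, fun y => ?_⟩
      · have := hcell k
        rw [if_pos h, h0 k hk] at this
        simpa using this
      · have : s.cell 5 κ 0 0 = κ / N := by linarith
        rw [this]
        simp only [sub_self, mul_zero, zero_mul, add_zero]
        positivity
    · refine ⟨b / (a + b), a / (a + b), by positivity, by positivity, by field_simp; ring,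
        fun k hk => ?_, fun y => ?_⟩
      · have := hcell k
        rw [if_neg h.not_ge, h0 k hk] at this
        rw [show s'.cell 2 k 0 0 = _ from this]
        by_cases h1 : k = κ
        · simp [h1]
        · by_cases h2 : k = κ + 1 <;> simp [h1, h2]
      -- The mesh h = 1/N turns h²/4 into the claimed bound.
      · have := two_point_calibration (p := κ / N) (h := 1 / N) (y := y) ha0 hb0 h
          (q := s.cell 5 κ 0 0) (q' := s.cell 5 (κ + 1) 0 0) (by rw [ha]; ring)
          (by rw [hb]; push_cast; ring)
        have e1 : ((κ + 1 : ℕ) : ℝ) / N = κ / N + 1 / N := by push_cast; ring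
        rw [e1]
        refine this.trans_eq ?_
        field_simp
  have hsum : ∀ f : ℕ → ℝ, ∑ k ∈ Finset.range (N + 1), s'.cell 2 k 0 0 * f k =
      α * f κ + β * f (κ + 1) := fun f => by
    rw [Finset.sum_congr rfl fun k hk' =>
      congrArg (· * f k) (hk k (Finset.mem_range.1 hk'))]
    simp only [add_mul, ite_mul, zero_mul, Finset.sum_add_distrib, Finset.sum_ite_eq',
      Finset.mem_range]
    rw [if_pos (by omega), if_pos (by omega)]
  refine ⟨fun k hk' => ?_, ?_, fun y => ?_⟩
  · rw [hk k hk']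
    exact add_nonneg (by split_ifs <;> simp [hα]) (by split_ifs <;> simp [hβ])
  · have := hsum 1
    simpa [hαβ] using this
  · rw [hsum]; exact hy y

theorem predictCmd_exec (s : Store) (hN : 0 < s.reg 2) :
    let s' := predictCmd.exec s
    (∀ k < s.reg 2 + 1, s'.cell 7 k 0 0 =
      ∑ i ∈ Finset.range (s.reg 0), s.cell 4 k i 0 * s.cell 0 i 0 0) ∧
    (∀ k < s.reg 2 + 1, 0 ≤ s'.cell 2 k 0 0) ∧
    ∑ k ∈ Finset.range (s.reg 2 + 1), s'.cell 2 k 0 0 = 1 ∧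
    ∀ y : ℝ, ∑ k ∈ Finset.range (s.reg 2 + 1),
      s'.cell 2 k 0 0 * (((k : ℝ) / s.reg 2 - y) ^ 2 - (clip (s'.cell 7 k 0 0) - y) ^ 2) ≤
        1 / (4 * (s.reg 2 : ℝ) ^ 2) := by
  intro s'
  obtain ⟨h7, h5, h2⟩ := linearPredictions_exec s
  set t := linearPredictions.exec s with ht
  have ht2 : t.reg 2 = s.reg 2 := KeepsReg.exec (by simp [linearPredictions, KeepsReg, sumInto]) _
  have hsel := selectCrossing_exec t (by rwa [ht2])
    (by rw [h5 0 (by omega)]; exact clip_nonneg _)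
  have hc : ∀ a, (selectCrossing.exec t).cell a = t.cell a := fun a =>
    KeepsArray.exec (by simp [selectCrossing, KeepsArray]) _
  have hu2 : (selectCrossing.exec t).reg 2 = s.reg 2 := by
    rw [KeepsReg.exec (by simp [selectCrossing, KeepsReg]), ht2]
  set u := selectCrossing.exec t with hu
  have hs' : s' = twoPointForecast.exec u := rfl
  obtain ⟨g1, g2, g3⟩ := hsel
  have key := twoPointForecast_exec u (by rw [hu2, ← ht2]; exact g1)
    (by rw [hc, hu2, ← ht2]; exact g2) (by
      rw [hc, hu2, ← ht2]
      rw [ht2] at *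
      -- For κ + 1 < N the inequality is the maximality of κ; for κ + 1 = N it is q_N ≤ 1, which
      -- truncation guarantees.
      rcases Nat.lt_or_ge (u.reg 6 + 1) (s.reg 2) with h | h
      · exact (g3 _ h (Nat.lt_succ_self _)).le
      · rw [h5 _ (by omega)]
        have h1 := clip_le_one (t.cell 7 (u.reg 6 + 1) 0 0)
        have h2 : (0 : ℝ) ≤ s.reg 2 := Nat.cast_nonneg _
        have h3 : (s.reg 2 : ℝ) ≤ ((u.reg 6 + 1 : ℕ) : ℝ) := by exact_mod_cast h
        nlinarith)
    (by rw [hc, hu2]; exact h2)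
  rw [hu2] at key
  have hs7 : s'.cell 7 = t.cell 7 := by
    rw [hs', KeepsArray.exec (by simp [twoPointForecast, KeepsArray]), hc]
  refine ⟨fun k hk => by rw [hs7]; exact h7 k hk, key.1, key.2.1, fun y => ?_⟩
  refine (Finset.sum_congr rfl fun k hk => ?_).trans_le (key.2.2 y)
  rw [hs7, hc, h5 k (Finset.mem_range.1 hk), hs']

theorem updateRow_exec (s : Store) :
    let s' := updateRow.exec s
    let k := s.reg 3
    let i := s.reg 4
    s'.cell 4 k i 0 = s.cell 4 k i 0 +
      s.cell 9 0 0 0 * (s.cell 1 0 0 0 - s.cell 7 k 0 0) * s.cell 6 i 0 0 ∧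
    ∀ j < s.reg 0, s'.cell 3 k i j =
      s.cell 3 k i j - s.cell 9 0 0 0 * (s.cell 6 i 0 0 * s.cell 6 j 0 0) := by
  intro s' k i
  set c := setCell 3 (.reg 3) (.reg 4) (.reg 5)
    (.sub (.cell 3 (.reg 3) (.reg 4) (.reg 5))
      (.mul (entry 9 (.lit 0)) (.mul (entry 6 (.reg 4)) (entry 6 (.reg 5))))) with hc
  set u := s.setCell 4 k i 0 (s.cell 4 k i 0 +
      s.cell 9 0 0 0 * (s.cell 1 0 0 0 - s.cell 7 k 0 0) * s.cell 6 i 0 0) with hu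
  have hs' : s' = (loop 5 (.reg 0) c).exec u := rfl
  have key := iter_parallel (v := 5) (f := c.exec) (s := u)
    (fun t => t.cell 9 = s.cell 9 ∧ t.cell 6 = s.cell 6 ∧ t.reg 3 = k ∧ t.reg 4 = i)
    (fun j t => t.cell 3 k i j = s.cell 3 k i j)
    (fun j t => t.cell 3 k i j =
      s.cell 3 k i j - s.cell 9 0 0 0 * (s.cell 6 i 0 0 * s.cell 6 j 0 0)) (n := s.reg 0)
    ⟨by funext x y z; simp [hu, Store.setCell_cell], by funext x y z; simp [hu, Store.setCell_cell],
      rfl, rfl⟩ (by simp [hu, Store.setCell_cell]) (by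
      rintro m hm t ⟨h1, h2, h3, h4⟩ hpre
      have hr3 : (t.setReg 5 m).reg 3 = k := by simp [Store.setReg_reg, h3]
      have hr4 : (t.setReg 5 m).reg 4 = i := by simp [Store.setReg_reg, h4]
      have hr5 : (t.setReg 5 m).reg 5 = m := by simp [Store.setReg_reg]
      refine ⟨⟨?_, ?_, ?_, ?_⟩, ?_, fun m' _ hm' => ?_⟩
      · rw [KeepsArray.exec (by simp [hc, KeepsArray])]; exact h1
      · rw [KeepsArray.exec (by simp [hc, KeepsArray])]; exact h2
      · rw [KeepsReg.exec (by simp [hc, KeepsReg])]; exact hr3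
      · rw [KeepsReg.exec (by simp [hc, KeepsReg])]; exact hr4
      · simp [hc, Cmd.exec, Store.setCell_cell, RExp.eval, IExp.eval, hr3, hr4, hr5, h1, h2, hpre]
      · have : (c.exec (t.setReg 5 m)).cell 3 k i m' = t.cell 3 k i m' := by
          simp [hc, Cmd.exec, Store.setCell_cell, IExp.eval, hr5, hm']
        rw [this]
        exact ⟨id, id⟩)
  refine ⟨?_, fun j hj => key.2 j hj⟩
  rw [hs', KeepsArray.exec (by simp [hc, KeepsArray])]
  simp [hu, Store.setCell_cell]

/-- The gain `w / (1 + w xᵀ B x)` of the weighted recursive least squares update of row `k`. -/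
noncomputable def gain (s : Store) (k : ℕ) : ℝ :=
  s.cell 2 k 0 0 / (1 + s.cell 2 k 0 0 * ∑ i ∈ Finset.range (s.reg 0), s.cell 0 i 0 0 *
    ∑ j ∈ Finset.range (s.reg 0), s.cell 3 k i j * s.cell 0 j 0 0)

/-- Row `k` after the weighted recursive least squares update. -/
def UpdatedRow (s s' : Store) (k : ℕ) : Prop :=
  (∀ i < s.reg 0, s'.cell 4 k i 0 = s.cell 4 k i 0 +
    gain s k * (s.cell 1 0 0 0 - s.cell 7 k 0 0) *
      ∑ l ∈ Finset.range (s.reg 0), s.cell 3 k i l * s.cell 0 l 0 0) ∧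
  ∀ i < s.reg 0, ∀ j < s.reg 0, s'.cell 3 k i j = s.cell 3 k i j -
    gain s k * ((∑ l ∈ Finset.range (s.reg 0), s.cell 3 k i l * s.cell 0 l 0 0) *
      ∑ l ∈ Finset.range (s.reg 0), s.cell 3 k j l * s.cell 0 l 0 0)

theorem matrixVector_exec (s : Store) {i : ℕ} (hi : i < s.reg 0) :
    (Cmd.exec (loop 4 (.reg 0) (sumInto 6 (.reg 4) 5 (.reg 0)
      (.mul (.cell 3 (.reg 3) (.reg 4) (.reg 5)) (entry 0 (.reg 5))))) s).cell 6 i 0 0 =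
        ∑ j ∈ Finset.range (s.reg 0), s.cell 3 (s.reg 3) i j * s.cell 0 j 0 0 := by
  set c := sumInto 6 (.reg 4) 5 (.reg 0)
      (.mul (.cell 3 (.reg 3) (.reg 4) (.reg 5)) (entry 0 (.reg 5))) with hc
  have harr : ∀ a ∈ ({0, 3} : Finset ℕ), c.KeepsArray a := by simp [hc, sumInto, KeepsArray]
  have hreg : ∀ r ∈ ({0, 3, 4} : Finset ℕ), c.KeepsReg r := by simp [hc, sumInto, KeepsReg]
  have hrow : c.RowOnly 4 6 := by simp [hc, sumInto, RowOnly]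
  refine (iter_parallel (v := 4) (f := c.exec) (s := s)
    (fun t => t.cell 0 = s.cell 0 ∧ t.cell 3 = s.cell 3 ∧ t.reg 0 = s.reg 0 ∧ t.reg 3 = s.reg 3)
    (fun _ _ => True)
    (fun i t => t.cell 6 i 0 0 =
      ∑ j ∈ Finset.range (s.reg 0), s.cell 3 (s.reg 3) i j * s.cell 0 j 0 0) (n := s.reg 0)
    ⟨rfl, rfl, rfl, rfl⟩ (by simp) ?_).2 i hi
  rintro m hm t ⟨h1, h2, h3, h4⟩ -
  have hr : ∀ r, r ≠ 4 → (t.setReg 4 m).reg r = t.reg r := fun r hr => by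
    rw [Store.setReg_reg, if_neg hr]
  have hr4 : (t.setReg 4 m).reg 4 = m := by simp [Store.setReg_reg]
  refine ⟨⟨?_, ?_, ?_, ?_⟩, ?_, fun m' _ hm' => ⟨id, ?_⟩⟩
  · rw [(harr 0 (by simp)).exec]; exact h1
  · rw [(harr 3 (by simp)).exec]; exact h2
  · rw [(hreg 0 (by simp)).exec, hr 0 (by decide), h3]
  · rw [(hreg 3 (by simp)).exec, hr 3 (by decide), h4]
  · refine sumInto_exec _ (fun s' hs' => ?_) ?_ (fun s' hs' => ?_) (fun s' l hl hs' hl' ha' => ?_)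
    · simp [IExp.eval, hs' 4 (by decide), hr4]
    · simp [IExp.eval, hr4]
    · simp [IExp.eval, hs', hr, h3]
    · simp [RExp.eval, IExp.eval, hs' 3 (by decide), hs' 4 (by decide), hr4, hr, hl', ha', h1, h2,
        h4]
  · rw [hrow.exec (hreg 4 (by simp)) _ (by rwa [hr4])]
    exact id

theorem updateRows_exec (s : Store) :
    let s' := (loop 4 (.reg 0) updateRow).exec s
    let k := s.reg 3
    (∀ i < s.reg 0, s'.cell 4 k i 0 = s.cell 4 k i 0 +
      s.cell 9 0 0 0 * (s.cell 1 0 0 0 - s.cell 7 k 0 0) * s.cell 6 i 0 0) ∧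
    ∀ i < s.reg 0, ∀ j < s.reg 0, s'.cell 3 k i j =
      s.cell 3 k i j - s.cell 9 0 0 0 * (s.cell 6 i 0 0 * s.cell 6 j 0 0) := by
  intro s' k
  have harr : ∀ a ∈ ({1, 6, 7, 9} : Finset ℕ), updateRow.KeepsArray a := by
    simp [updateRow, KeepsArray]
  have hreg : ∀ r ∈ ({0, 3, 4} : Finset ℕ), updateRow.KeepsReg r := by simp [updateRow, KeepsReg]
  have hcol : ∀ a ∈ ({3, 4} : Finset ℕ), updateRow.ColOnly 4 a := by simp [updateRow, ColOnly]
  have key := (iter_parallel (v := 4) (f := updateRow.exec) (s := s)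
    (fun t => (∀ a ∈ ({1, 6, 7, 9} : Finset ℕ), t.cell a = s.cell a) ∧
      t.reg 0 = s.reg 0 ∧ t.reg 3 = k)
    (fun i t => t.cell 4 k i = s.cell 4 k i ∧ t.cell 3 k i = s.cell 3 k i)
    (fun i t => t.cell 4 k i 0 = s.cell 4 k i 0 +
      s.cell 9 0 0 0 * (s.cell 1 0 0 0 - s.cell 7 k 0 0) * s.cell 6 i 0 0 ∧
      ∀ j < s.reg 0, t.cell 3 k i j =
        s.cell 3 k i j - s.cell 9 0 0 0 * (s.cell 6 i 0 0 * s.cell 6 j 0 0)) (n := s.reg 0)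
    ⟨fun _ _ => rfl, rfl, rfl⟩ (fun _ _ => ⟨rfl, rfl⟩) ?_).2
  · exact ⟨fun i hi => (key i hi).1, fun i hi => (key i hi).2⟩
  rintro m hm t ⟨h1, h3, h4⟩ ⟨hp4, hp3⟩
  set u := t.setReg 4 m with hu
  have hr : ∀ r, r ≠ 4 → u.reg r = t.reg r := fun r hr => by
    rw [hu, Store.setReg_reg, if_neg hr]
  have hr4 : u.reg 4 = m := by simp [hu, Store.setReg_reg]
  have hu3 : u.reg 3 = k := by rw [hr 3 (by decide), h4]
  have huc : u.cell = t.cell := rfl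
  refine ⟨⟨fun a ha => ?_, ?_, ?_⟩, ?_, fun m' _ hm' => ?_⟩
  · rw [(harr a ha).exec]; exact h1 a ha
  · rw [(hreg 0 (by simp)).exec, hr 0 (by decide), h3]
  · rw [(hreg 3 (by simp)).exec, hu3]
  · have := updateRow_exec u
    simp only [hu3, hr4, hr 0 (by decide), h3, huc, h1 1 (by simp), h1 6 (by simp),
      h1 7 (by simp), h1 9 (by simp), hp3, hp4] at this
    exact this
  · rw [(hcol 4 (by simp)).exec (hreg 4 (by simp)) u (by rwa [hr4]),
      (hcol 3 (by simp)).exec (hreg 4 (by simp)) u (by rwa [hr4]), huc]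
    exact ⟨id, id⟩

theorem updateRegression_exec (s : Store) :
    UpdatedRow s (updateRegression.exec s) (s.reg 3) := by
  set k := s.reg 3 with hk
  set c₁ := loop 4 (.reg 0) (sumInto 6 (.reg 4) 5 (.reg 0)
    (.mul (.cell 3 (.reg 3) (.reg 4) (.reg 5)) (entry 0 (.reg 5)))) with hc₁
  set c₂ := sumInto 8 (.lit 0) 4 (.reg 0) (.mul (entry 0 (.reg 4)) (entry 6 (.reg 4))) with hc₂
  set c₃ := setEntry 9 (.lit 0) (.div (entry 2 (.reg 3))
    (.add (.lit 1) (.mul (entry 2 (.reg 3)) (entry 8 (.lit 0))))) with hc₃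
  have hexec : updateRegression.exec s =
    (loop 4 (.reg 0) updateRow).exec (c₃.exec (c₂.exec (c₁.exec s))) := rfl
  have hreg1 : ∀ r ∈ ({0, 3} : Finset ℕ), (c₁.exec s).reg r = s.reg r := fun r hr => by
    refine KeepsReg.exec ?_ s
    revert r; simp [hc₁, sumInto, KeepsReg]
  have harr1 : ∀ a ≠ 6, (c₁.exec s).cell a = s.cell a := fun a ha =>
    KeepsArray.exec (by simpa [hc₁, sumInto, KeepsArray] using ha) s
  have h6 : ∀ i < s.reg 0, (c₁.exec s).cell 6 i 0 0 =
      ∑ l ∈ Finset.range (s.reg 0), s.cell 3 k i l * s.cell 0 l 0 0 :=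
    fun i hi => matrixVector_exec s hi
  set t := c₁.exec s with ht
  have hreg2 : ∀ r ∈ ({0, 3} : Finset ℕ), (c₂.exec t).reg r = s.reg r := fun r hr => by
    rw [← hreg1 r hr]
    refine KeepsReg.exec ?_ t
    revert r; simp [hc₂, sumInto, KeepsReg]
  have harr2 : ∀ a ≠ 8, (c₂.exec t).cell a = t.cell a := fun a ha =>
    KeepsArray.exec (by simpa [hc₂, sumInto, KeepsArray] using ha) t
  have h8 : (c₂.exec t).cell 8 0 0 0 = ∑ i ∈ Finset.range (s.reg 0), s.cell 0 i 0 0 *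
      ∑ j ∈ Finset.range (s.reg 0), s.cell 3 k i j * s.cell 0 j 0 0 := by
    refine sumInto_exec _ (fun s' hs' => rfl) rfl (fun s' hs' => ?_) (fun s' l hl hs' hl' ha' => ?_)
    · simp [IExp.eval, hs', hreg1]
    · simp [RExp.eval, IExp.eval, hl', ha', harr1, h6 l hl]
  set u := c₂.exec t with hu
  have hreg3 : ∀ r ∈ ({0, 3} : Finset ℕ), (c₃.exec u).reg r = s.reg r := hreg2
  have harr3 : ∀ a ≠ 9, (c₃.exec u).cell a = u.cell a := fun a ha =>
    KeepsArray.exec (by simpa [hc₃, KeepsArray] using ha) u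
  have h9 : (c₃.exec u).cell 9 0 0 0 = gain s k := by
    simp [hc₃, Cmd.exec, Store.setCell_cell, RExp.eval, IExp.eval, h8, gain, hreg2, harr2, harr1,
      ← hk]
  have key := updateRows_exec (c₃.exec u)
  have hcell : ∀ a ∈ ({0, 1, 2, 3, 4, 7} : Finset ℕ), (c₃.exec u).cell a = s.cell a := by
    intro a ha
    have : a ≠ 9 ∧ a ≠ 8 ∧ a ≠ 6 := by revert a; decide
    rw [harr3 a this.1, harr2 a this.2.1, harr1 a this.2.2]
  have h6' : ∀ i < s.reg 0, (c₃.exec u).cell 6 i 0 0 =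
      ∑ l ∈ Finset.range (s.reg 0), s.cell 3 k i l * s.cell 0 l 0 0 := fun i hi => by
    rw [harr3 6 (by decide), harr2 6 (by decide), h6 i hi]
  rw [hexec]
  simp only [hreg3 0 (by simp), hreg3 3 (by simp), ← hk, hcell 4 (by simp), hcell 1 (by simp),
    hcell 7 (by simp), hcell 3 (by simp), h9] at key
  refine ⟨fun i hi => ?_, fun i hi j hj => ?_⟩
  · rw [key.1 i hi, h6' i hi]
  · rw [key.2 i hi j hj, h6' i hi, h6' j hj]

/-- The update of a grid point writes the regression arrays only in its own row and leaves context,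
label, forecast and predictions alone, so all rows are updated as if simultaneously from `s`. -/
theorem updateCmd_exec (s : Store) {k : ℕ} (hk : k < s.reg 2 + 1) :
    UpdatedRow s (updateCmd.exec s) k := by
  have harr : ∀ a ∈ ({0, 1, 2, 7} : Finset ℕ), updateRegression.KeepsArray a := by
    simp [updateRegression, updateRow, sumInto, KeepsArray]
  have hreg : ∀ r ∈ ({0, 3} : Finset ℕ), updateRegression.KeepsReg r := by
    simp [updateRegression, updateRow, sumInto, KeepsReg]
  have hrow : ∀ a ∈ ({3, 4} : Finset ℕ), updateRegression.RowOnly 3 a := by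
    simp [updateRegression, updateRow, sumInto, RowOnly]
  refine (iter_parallel (v := 3) (f := updateRegression.exec) (s := s)
    (fun t => (∀ a ∈ ({0, 1, 2, 7} : Finset ℕ), t.cell a = s.cell a) ∧ t.reg 0 = s.reg 0)
    (fun k t => t.cell 3 k = s.cell 3 k ∧ t.cell 4 k = s.cell 4 k)
    (fun k t => UpdatedRow s t k) (n := s.reg 2 + 1)
    ⟨fun _ _ => rfl, rfl⟩ (fun _ _ => ⟨rfl, rfl⟩) ?_).2 k hk
  rintro m hm t ⟨h1, h0⟩ ⟨hp3, hp4⟩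
  set u := t.setReg 3 m with hu
  have hu0 : u.reg 0 = s.reg 0 := by simp [hu, Store.setReg_reg, h0]
  have hu3 : u.reg 3 = m := by simp [hu, Store.setReg_reg]
  have huc : u.cell = t.cell := rfl
  refine ⟨⟨fun a ha => ?_, ?_⟩, ?_, fun m' _ hm' => ?_⟩
  · rw [(harr a ha).exec]; exact h1 a ha
  · rw [(hreg 0 (by simp)).exec, hu0]
  · have := updateRegression_exec u
    simp only [UpdatedRow, gain, hu3, hu0, huc, h1 0 (by simp), h1 1 (by simp), h1 2 (by simp),
      h1 7 (by simp), hp3, hp4] at this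
    exact this
  · have e3 := (hrow 3 (by simp)).exec (hreg 3 (by simp)) u (m := m') (by rwa [hu3])
    have e4 := (hrow 4 (by simp)).exec (hreg 3 (by simp)) u (m := m') (by rwa [hu3])
    rw [huc] at e3 e4
    simp only [UpdatedRow, e3, e4]
    exact ⟨id, id⟩

/-! ### The run of the program over the rounds -/

open OnlineProgram Matrix

variable {d : ℕ} (T N : ℕ) (x : ℕ → contextSet d) (y : ℕ → ℝ)

/-- The store on which `predict` runs in round `t`. -/
noncomputable def preStore (t : ℕ) : Store := loadContext (program.memory d T N x y t) (x t)

/-- The store on which `update` runs in round `t`. -/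
noncomputable def postStore (t : ℕ) : Store := loadLabel (predictCmd.exec (preStore T N x y t)) (y t)

/-- The probability of the prediction `k / N` in round `t`. -/
noncomputable def weight (t k : ℕ) : ℝ := (program.midMemory d T N x y t).cell 2 k 0 0

/-- The truncated ridge prediction for the grid point `k / N` in round `t`. -/
noncomputable def truncatedPrediction (t k : ℕ) : ℝ :=
  clip ((program.midMemory d T N x y t).cell 7 k 0 0)

theorem preStore_reg {v : ℕ} (hv : v < 3) (t : ℕ) :
    (preStore T N x y t).reg v = (blank d T N).reg v := by
  change (program.memory d T N x y t).reg v = _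
  induction t with
  | zero => exact (initCmd_static.keepsReg hv).exec _
  | succ t ih =>
    refine ((updateCmd_static.keepsReg hv).exec _).trans ?_
    exact ((predictCmd_static.keepsReg hv).exec _).trans ih

theorem postStore_reg {v : ℕ} (hv : v < 3) (t : ℕ) :
    (postStore T N x y t).reg v = (blank d T N).reg v :=
  ((predictCmd_static.keepsReg hv).exec _).trans (preStore_reg T N x y hv t)

theorem preStore_context (t : ℕ) (i : Fin d) :
    (preStore T N x y t).cell 0 i 0 0 = (x t : EuclideanSpace ℝ (Fin d)) i := by
  simp [preStore, loadContext]

theorem preStore_cell {a : ℕ} (ha : a ≠ 0) (t : ℕ) :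
    (preStore T N x y t).cell a = (program.memory d T N x y t).cell a := by
  funext i j k
  simp [preStore, loadContext, ha]

theorem predictCmd_keepsArray {a : ℕ} (ha : a = 0 ∨ a = 3 ∨ a = 4) :
    predictCmd.KeepsArray a := by
  rcases ha with rfl | rfl | rfl <;>
  simp [predictCmd, linearPredictions, selectCrossing, twoPointForecast, sumInto, KeepsArray]

theorem postStore_cell {a : ℕ} (ha : a ≠ 1) (t : ℕ) :
    (postStore T N x y t).cell a = (program.midMemory d T N x y t).cell a := by
  funext i j k
  exact if_neg fun h => ha h.1

theorem postStore_label (t : ℕ) : (postStore T N x y t).cell 1 0 0 0 = y t := by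
  simp [postStore, loadLabel, Store.setCell_cell]

theorem postStore_context (t : ℕ) (i : Fin d) :
    (postStore T N x y t).cell 0 i 0 0 = (x t : EuclideanSpace ℝ (Fin d)) i := by
  rw [postStore_cell T N x y (by decide), ← preStore_context T N x y t i]
  exact congrFun (congrFun (congrFun ((predictCmd_keepsArray (.inl rfl)).exec _) _) _) _

theorem postStore_memory {a : ℕ} (ha : a = 3 ∨ a = 4) (t : ℕ) :
    (postStore T N x y t).cell a = (program.memory d T N x y t).cell a := by
  rw [postStore_cell T N x y (by omega), ← preStore_cell T N x y (by omega)]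
  exact (predictCmd_keepsArray (.inr ha)).exec _

theorem blank_reg_zero : (blank d T N).reg 0 = d := rfl

theorem blank_reg_two : (blank d T N).reg 2 = N := rfl

theorem midMemory_spec (hN : 0 < N) (t : ℕ) :
    (∀ k < N + 1, (program.midMemory d T N x y t).cell 7 k 0 0 =
      ∑ i : Fin d, (program.memory d T N x y t).cell 4 k i 0 *
        (x t : EuclideanSpace ℝ (Fin d)) i) ∧
    (∀ k < N + 1, 0 ≤ weight T N x y t k) ∧
    ∑ k ∈ Finset.range (N + 1), weight T N x y t k = 1 ∧
    ∀ z : ℝ, ∑ k ∈ Finset.range (N + 1), weight T N x y t k *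
      (((k : ℝ) / N - z) ^ 2 - (truncatedPrediction T N x y t k - z) ^ 2) ≤
        1 / (4 * (N : ℝ) ^ 2) := by
  have h := predictCmd_exec (preStore T N x y t)
  simp only [preStore_reg T N x y (show 0 < 3 by decide), preStore_reg T N x y (show 2 < 3 by decide),
    blank_reg_zero, blank_reg_two] at h
  obtain ⟨h1, h2, h3, h4⟩ := h hN
  refine ⟨fun k hk => (h1 k hk).trans ?_, h2, h3, h4⟩
  rw [Finset.sum_range]
  refine Finset.sum_congr rfl fun i _ => ?_
  rw [preStore_context, preStore_cell T N x y (by decide)]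

theorem weight_le_one (hN : 0 < N) (t : ℕ) {k : ℕ} (hk : k < N + 1) :
    weight T N x y t k ≤ 1 := by
  obtain ⟨-, h2, h3, -⟩ := midMemory_spec T N x y hN t
  rw [← h3]
  exact Finset.single_le_sum (fun j hj => h2 j (Finset.mem_range.1 hj)) (Finset.mem_range.2 hk)

/-- The regression matrix of row `k` at the beginning of round `t`. -/
noncomputable def inverseGram (k t : ℕ) : Matrix (Fin d) (Fin d) ℝ :=
  .of fun i j => (program.memory d T N x y t).cell 3 k i j

/-- The regression estimate of row `k` at the beginning of round `t`. -/
noncomputable def estimate (k t : ℕ) : Fin d → ℝ :=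
  fun i => (program.memory d T N x y t).cell 4 k i 0

theorem initial_rows {k : ℕ} (hk : k < N + 1) :
    inverseGram T N x y k 0 = 1 ∧ estimate T N x y k 0 = 0 := by
  constructor
  · ext i j
    have := initCmd_exec (blank d T N) (fun _ _ _ => rfl) k hk i i.2 j
    refine this.trans ?_
    simp [Matrix.one_apply, Fin.ext_iff]
  · funext i
    have h : initCmd.KeepsArray 4 := by simp [initCmd, KeepsArray]
    exact congrFun (congrFun (congrFun (h.exec (blank d T N)) k) i) 0

/-- The recursion required by `ridge_regret`. `predict` leaves context, matrices and estimates
unchanged, so `update` sees those of the beginning of the round. -/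
theorem updated_rows (hN : 0 < N) {k : ℕ} (hk : k < N + 1) (t : ℕ) :
    let X : Fin d → ℝ := (x t : EuclideanSpace ℝ (Fin d))
    let w := weight T N x y t k
    let B := inverseGram T N x y k t
    let θ := estimate T N x y k t
    inverseGram T N x y k (t + 1) =
      B - (w / (1 + w * (X ⬝ᵥ B *ᵥ X))) • vecMulVec (B *ᵥ X) (B *ᵥ X) ∧
    estimate T N x y k (t + 1) =
      θ + (w / (1 + w * (X ⬝ᵥ B *ᵥ X)) * (y t - X ⬝ᵥ θ)) • B *ᵥ X := by
  intro X w B θ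
  have hreg0 : (postStore T N x y t).reg 0 = d := postStore_reg T N x y (by decide) t
  have hreg2 : (postStore T N x y t).reg 2 = N := postStore_reg T N x y (by decide) t
  obtain ⟨h1, h2⟩ := updateCmd_exec (postStore T N x y t) (k := k) (by rwa [hreg2])
  have hBX : ∀ i : Fin d, ∑ l ∈ Finset.range d, (postStore T N x y t).cell 3 k i l *
      (postStore T N x y t).cell 0 l 0 0 = (B *ᵥ X) i := fun i => by
    rw [Finset.sum_range]
    refine Finset.sum_congr rfl fun l _ => ?_
    rw [postStore_context, postStore_memory T N x y (.inl rfl)]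
    rfl
  have hgain : gain (postStore T N x y t) k = w / (1 + w * (X ⬝ᵥ B *ᵥ X)) := by
    simp only [gain, hreg0, postStore_cell T N x y (show 2 ≠ 1 by decide)]
    congr 3
    rw [Finset.sum_range]
    exact Finset.sum_congr rfl fun i _ => by rw [postStore_context, hBX]
  have h7 : (postStore T N x y t).cell 7 k 0 0 = X ⬝ᵥ θ := by
    rw [postStore_cell T N x y (by decide), (midMemory_spec T N x y hN t).1 k hk, dotProduct_comm]
    rfl
  rw [hreg0] at h1 h2
  constructor
  · ext i j
    have := h2 i i.2 j j.2
    rw [hBX, hBX, hgain, postStore_memory T N x y (.inl rfl)] at this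
    exact this
  · funext i
    have := h1 i i.2
    rw [hBX, hgain, h7, postStore_label, postStore_memory T N x y (.inr rfl)] at this
    exact this

theorem contextSet_dotProduct_self_le (x : contextSet d) :
    (x : EuclideanSpace ℝ (Fin d)).ofLp ⬝ᵥ (x : EuclideanSpace ℝ (Fin d)).ofLp ≤ 1 := by
  have h := EuclideanSpace.real_norm_sq_eq (x : EuclideanSpace ℝ (Fin d))
  have h1 := x.2.1
  have h2 := norm_nonneg (x : EuclideanSpace ℝ (Fin d))
  simp only [dotProduct, ← pow_two]
  rw [← h]
  nlinarith

/-- Regret of the ridge regression for the grid point `k / N`. -/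
theorem row_regret (hN : 0 < N) (hy : ∀ t, y t = 0 ∨ y t = 1) {k : ℕ} (hk : k < N + 1)
    (ϑ : EuclideanSpace ℝ (Fin d)) :
    ∑ t ∈ Finset.range T, weight T N x y t k *
      ((truncatedPrediction T N x y t k - y t) ^ 2 -
        (inner ℝ ϑ (x t : EuclideanSpace ℝ (Fin d)) - y t) ^ 2) ≤
      ‖ϑ‖ ^ 2 + d * Real.log (d + T) := by
  have hpred : ∀ t, (program.midMemory d T N x y t).cell 7 k 0 0 =
      (x t : EuclideanSpace ℝ (Fin d)).ofLp ⬝ᵥ estimate T N x y k t := fun t => by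
    rw [(midMemory_spec T N x y hN t).1 k hk, dotProduct_comm]
    rfl
  have key := ridge_regret T (fun t => (x t : EuclideanSpace ℝ (Fin d)).ofLp)
    (estimate T N x y k) (inverseGram T N x y k) (fun t => weight T N x y t k) y
    (fun t => truncatedPrediction T N x y t k) (initial_rows T N x y hk).1
    (initial_rows T N x y hk).2 (fun t _ => (updated_rows T N x y hN hk t).1)
    (fun t _ => (updated_rows T N x y hN hk t).2)
    (fun t _ => (midMemory_spec T N x y hN t).2.1 k hk) (fun t _ => weight_le_one T N x y hN t hk)
    (fun t _ => contextSet_dotProduct_self_le (x t))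
    (fun t _ => sq_clip_sub_le_one _ (hy t))
    (fun t _ => by rw [← hpred]; exact sq_clip_sub_le _ (hy t)) ϑ.ofLp
  have e1 : ∀ t, (x t : EuclideanSpace ℝ (Fin d)).ofLp ⬝ᵥ ϑ.ofLp =
      inner ℝ ϑ (x t : EuclideanSpace ℝ (Fin d)) := fun t => by
    simp [EuclideanSpace.inner_eq_star_dotProduct]
  have e2 : ϑ.ofLp ⬝ᵥ ϑ.ofLp = ‖ϑ‖ ^ 2 := by
    rw [EuclideanSpace.real_norm_sq_eq]
    simp [dotProduct, pow_two]
  simpa only [e1, e2, Fintype.card_fin] using key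

/-- The forecast of round `t`. -/
noncomputable def forecast (hN : 0 < N) (t : Fin T) : PMF (Fin (N + 1)) :=
  PMF.ofFintype (fun k => ENNReal.ofReal (weight T N x y t k)) (by
    obtain ⟨-, h2, h3, -⟩ := midMemory_spec T N x y hN t
    rw [← ENNReal.ofReal_sum_of_nonneg fun k _ => h2 _ k.2, ← Finset.sum_range
      (fun k => weight T N x y t k), h3, ENNReal.ofReal_one])

theorem forecast_toReal (hN : 0 < N) (t : Fin T) (k : Fin (N + 1)) :
    (forecast T N x y hN t k).toReal = weight T N x y t k := by
  rw [forecast, PMF.ofFintype_apply,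
    ENNReal.toReal_ofReal ((midMemory_spec T N x y hN t).2.1 k k.2)]

/-- Pseudo swap regret of the forecasts against linear functions. -/
theorem forecast_pseudo_regret (hN : 0 < N) (hy : ∀ t, y t = 0 ∨ y t = 1)
    (ϑ : Fin (N + 1) → EuclideanSpace ℝ (Fin d)) {R : ℝ} (hR : ∀ k, ‖ϑ k‖ ≤ R) :
    ∑ t : Fin T, ∑ k : Fin (N + 1), (forecast T N x y hN t k).toReal *
      ((((k : ℕ) : ℝ) / N - y t) ^ 2 -
        (inner ℝ (ϑ k) (x t : EuclideanSpace ℝ (Fin d)) - y t) ^ 2) ≤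
      T / (4 * (N : ℝ) ^ 2) + (N + 1) * (R ^ 2 + d * Real.log (d + T)) := by
  have h1 : ∀ t : Fin T, ∑ k : Fin (N + 1), weight T N x y t k *
      ((((k : ℕ) : ℝ) / N - y t) ^ 2 - (truncatedPrediction T N x y t k - y t) ^ 2) ≤
        1 / (4 * (N : ℝ) ^ 2) := fun t => by
    have := (midMemory_spec T N x y hN t).2.2.2 (y t)
    rwa [Finset.sum_range] at this
  have h2 : ∀ k : Fin (N + 1), ∑ t : Fin T, weight T N x y t k *
      ((truncatedPrediction T N x y t k - y t) ^ 2 -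
        (inner ℝ (ϑ k) (x t : EuclideanSpace ℝ (Fin d)) - y t) ^ 2) ≤
      R ^ 2 + d * Real.log (d + T) := fun k => by
    have := row_regret T N x y hN hy k.2 (ϑ k)
    rw [Finset.sum_range] at this
    have h3 : ‖ϑ k‖ ^ 2 ≤ R ^ 2 := pow_le_pow_left₀ (norm_nonneg _) (hR k) 2
    linarith
  -- Insert the loss of the truncated predictions: what remains is the calibration error, bounded
  -- round by round, and the regression regret, bounded grid point by grid point.
  calc _ = ∑ t : Fin T, ∑ k : Fin (N + 1), weight T N x y t k *
        ((((k : ℕ) : ℝ) / N - y t) ^ 2 - (truncatedPrediction T N x y t k - y t) ^ 2) +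
      ∑ k : Fin (N + 1), ∑ t : Fin T, weight T N x y t k *
        ((truncatedPrediction T N x y t k - y t) ^ 2 -
          (inner ℝ (ϑ k) (x t : EuclideanSpace ℝ (Fin d)) - y t) ^ 2) := by
        rw [Finset.sum_comm (s := (Finset.univ : Finset (Fin (N + 1)))),
          ← Finset.sum_add_distrib]
        refine Finset.sum_congr rfl fun t _ => ?_
        rw [← Finset.sum_add_distrib]
        refine Finset.sum_congr rfl fun k _ => ?_
        rw [forecast_toReal]
        ring
    _ ≤ ∑ _t : Fin T, 1 / (4 * (N : ℝ) ^ 2) +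
        ∑ _k : Fin (N + 1), (R ^ 2 + d * Real.log (d + T)) :=
      add_le_add (Finset.sum_le_sum fun t _ => h1 t) (Finset.sum_le_sum fun k _ => h2 k)
    _ = _ := by simp; ring

/-! ### Output and running time -/

theorem program_outputs (hN : 0 < N) :
    program.Outputs d T N x y (forecast T N x y hN) := fun t k => by
  rw [forecast_toReal]; rfl

theorem program_totalTime_le :
    program.totalTime d T N x y ≤ initCmd.cost (blank d T N) +
      T * (predictCmd.cost (blank d T N) + updateCmd.cost (blank d T N)) := by
  refine add_le_add (initCmd_static.time_le_cost fun _ _ => rfl) ?_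
  calc _ ≤ ∑ _t ∈ Finset.range T, (predictCmd.cost (blank d T N) + updateCmd.cost (blank d T N)) :=
        Finset.sum_le_sum fun t _ => add_le_add
          (predictCmd_static.time_le_cost fun v hv => preStore_reg T N x y hv t)
          (updateCmd_static.time_le_cost fun v hv => postStore_reg T N x y hv t)
    _ = _ := by simp

/-- The dominant cost is the update: T rounds, N + 1 matrices, d² entries each, with N ≤ 2T. -/
theorem program_totalTime_le_pow (hd : 1 ≤ d) (hT : 2 ≤ T) (hN : N ≤ 2 * T) :
    program.totalTime d T N x y ≤ 1000 * (d + T) ^ 4 := by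
  refine (program_totalTime_le T N x y).trans ?_
  obtain ⟨M, hM⟩ : ∃ M, M = d + T := ⟨_, rfl⟩
  rw [← hM]
  have h1 : d ≤ M := by omega
  have h2 : T ≤ M := by omega
  have h3 : N ≤ 2 * M := by omega
  have h4 : 1 ≤ M := by omega
  simp only [initCmd, predictCmd, linearPredictions, selectCrossing, twoPointForecast, updateCmd,
    updateRegression, updateRow, sumInto, Cmd.cost, IExp.size, RExp.size, IExp.eval,
    blank_reg_zero, blank_reg_two]
  have hpow : ∀ i ≤ 4, M ^ i ≤ M ^ 4 := fun i hi => Nat.pow_le_pow_right h4 hi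
  have p0 := hpow 0 (by decide)
  have p1 := hpow 1 (by decide)
  have p2 := hpow 2 (by decide)
  have p3 := hpow 3 (by decide)
  ring_nf
  calc _ ≤ 7 + 2 * M * 3 + 2 * M * M * 6 + 2 * M * M * M * 77 + 2 * M * M ^ 2 * M * 43 +
        2 * M * M * 90 + M * 6 + M * M * 77 + M ^ 2 * M * 43 + M * 173 := by gcongr
    _ = 7 * M ^ 0 + 185 * M ^ 1 + 269 * M ^ 2 + 197 * M ^ 3 + 86 * M ^ 4 := by ring
    -- The coefficients add up to 744.
    _ ≤ M ^ 4 * 1000 := by omega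

end Forecaster

/-! ### Contextual swap regret against bounded linear functions -/

section LinearClass

variable {d : ℕ}

/-- Let η be the part of θ orthogonal to the first basis vector e. Testing on e/2 ± η/(2‖η‖), which
lie in the context set, gives |θ₁|/2 + ‖η‖/2 ≤ 2. -/
theorem norm_le_of_bounded_on_contextSet (hd : 1 ≤ d) (θ : EuclideanSpace ℝ (Fin d))
    (h : ∀ x : contextSet d, inner ℝ θ (x : EuclideanSpace ℝ (Fin d)) ^ 2 ≤ 4) : ‖θ‖ ≤ 4 := by
  set i₀ : Fin d := ⟨0, hd⟩
  set e : EuclideanSpace ℝ (Fin d) := EuclideanSpace.single i₀ 1 with he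
  set η := θ - θ i₀ • e with hη
  have hen : ‖e‖ = 1 := by simp [he]
  have hη0 : η i₀ = 0 := by simp [hη, he]
  have heη : inner ℝ e η = 0 := by simp [he, EuclideanSpace.inner_single_left, hη0]
  have hθe : inner ℝ θ e = θ i₀ := by simp [he, EuclideanSpace.inner_single_right]
  have hθη : inner ℝ θ η = ‖η‖ ^ 2 := by
    have : θ = η + θ i₀ • e := by simp [hη]
    conv_lhs => rw [this]
    rw [inner_add_left, real_inner_smul_left, heη, real_inner_self_eq_norm_sq, mul_zero, add_zero]
  -- If η = 0 then c = 0 by convention, and the test points degenerate to e/2.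
  set c : ℝ := (2 * ‖η‖)⁻¹ with hc
  have hcη : c * ‖η‖ ^ 2 = ‖η‖ / 2 := by
    rcases eq_or_ne ‖η‖ 0 with h0 | h0
    · simp [h0]
    · rw [hc]; field_simp
  have hcn : ‖c • η‖ ≤ 1 / 2 := by
    rw [norm_smul, Real.norm_of_nonneg (by positivity : 0 ≤ c)]
    rcases eq_or_ne ‖η‖ 0 with h0 | h0
    · simp [h0]
    · rw [hc]; apply le_of_eq; field_simp
  have hmem : ∀ σ : ℝ, |σ| = 1 → (1 / 2 : ℝ) • e + σ • c • η ∈ contextSet d := by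
    intro σ hσ
    refine ⟨?_, fun i hi => ?_⟩
    · calc _ ≤ ‖(1 / 2 : ℝ) • e‖ + ‖σ • c • η‖ := norm_add_le _ _
        _ ≤ 1 / 2 + 1 / 2 := by
          rw [norm_smul σ, Real.norm_eq_abs σ, hσ, norm_smul, hen]
          norm_num at hcn ⊢
          linarith
        _ = 1 := by norm_num
    · have : i = i₀ := Fin.ext hi
      subst this
      simp [hη0, he]
  have hval : ∀ σ : ℝ, inner ℝ θ ((1 / 2 : ℝ) • e + σ • c • η) = θ i₀ / 2 + σ * (‖η‖ / 2) := by
    intro σ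
    rw [inner_add_right, real_inner_smul_right, real_inner_smul_right, real_inner_smul_right, hθe,
      hθη, hcη]
    ring
  have h1 := h ⟨_, hmem 1 (by simp)⟩
  have h2 := h ⟨_, hmem (-1) (by simp)⟩
  rw [hval] at h1 h2
  have h4 := abs_le_of_sq_le_sq' (show (θ i₀ / 2 + -1 * (‖η‖ / 2)) ^ 2 ≤ (2 : ℝ) ^ 2 by linarith)
    (by norm_num)
  have h5 := abs_le_of_sq_le_sq' (show (θ i₀ / 2 + 1 * (‖η‖ / 2)) ^ 2 ≤ (2 : ℝ) ^ 2 by linarith)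
    (by norm_num)
  have h6 : |θ i₀| + ‖η‖ ≤ 4 := by
    rcases abs_cases (θ i₀) with ⟨h, _⟩ | ⟨h, _⟩ <;> rw [h] <;> linarith [h4.1, h4.2, h5.1, h5.2]
  calc ‖θ‖ = ‖η + θ i₀ • e‖ := by simp [hη]
    _ ≤ ‖η‖ + ‖θ i₀ • e‖ := norm_add_le _ _
    _ = ‖η‖ + |θ i₀| := by rw [norm_smul, hen, mul_one, Real.norm_eq_abs]
    _ ≤ 4 := by linarith

/-- The vector with coordinates `z i / D`. -/
noncomputable def gridVector (D : ℕ) (z : Fin d → ℤ) : EuclideanSpace ℝ (Fin d) :=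
  WithLp.toLp 2 fun i => (z i : ℝ) / D

/-- Round each coordinate down. The error is at most √d/D, weakened to d/D. -/
theorem exists_gridVector_near {D : ℕ} (hD : 0 < D) (θ : EuclideanSpace ℝ (Fin d))
    (hθ : ‖θ‖ ≤ 4) :
    ∃ z ∈ Fintype.piFinset fun _ : Fin d => Finset.Icc (-(5 * D : ℤ)) (5 * D),
      ‖θ - gridVector D z‖ ≤ d / D := by
  have hD' : (0 : ℝ) < D := by exact_mod_cast hD
  refine ⟨fun i => ⌊θ i * D⌋, ?_, ?_⟩
  · rw [Fintype.mem_piFinset]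
    intro i
    have h1 : |θ i| ≤ 4 := by
      rw [← Real.norm_eq_abs]
      exact (PiLp.norm_apply_le θ i).trans hθ
    obtain ⟨h2, h3⟩ := abs_le.1 h1
    rw [Finset.mem_Icc]
    constructor
    · rw [Int.le_floor]; push_cast; nlinarith
    · have h4 := Int.floor_le (θ i * D)
      have h5 : (⌊θ i * D⌋ : ℝ) ≤ 5 * D := by nlinarith
      exact_mod_cast h5
  · have hcoord : ∀ i, (θ - gridVector D fun i => ⌊θ i * D⌋) i ^ 2 ≤ (1 / D : ℝ) ^ 2 := by
      intro i
      have h4 := Int.floor_le (θ i * D)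
      have h5 := (Int.lt_floor_add_one (θ i * D)).le
      have : (θ - gridVector D fun i => ⌊θ i * D⌋) i = (θ i * D - ⌊θ i * D⌋) / D := by
        simp only [gridVector, PiLp.sub_apply]
        field_simp
      rw [this]
      refine pow_le_pow_left₀ (div_nonneg (by linarith) hD'.le) ?_ 2
      gcongr
      linarith
    refine abs_le_of_sq_le_sq (?_ : _ ≤ (d / D : ℝ) ^ 2) (by positivity) |>.trans' (le_abs_self _)
    rw [EuclideanSpace.real_norm_sq_eq]
    calc _ ≤ ∑ _i : Fin d, (1 / D : ℝ) ^ 2 := Finset.sum_le_sum fun i _ => hcoord i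
      _ = d * (1 / D : ℝ) ^ 2 := by simp
      _ ≤ (d / D : ℝ) ^ 2 := by
        rw [div_pow, div_pow, one_pow, mul_one_div]
        gcongr
        have : d ≤ d ^ 2 := Nat.le_self_pow two_ne_zero d
        exact_mod_cast this

/-- A real supremum is bounded through `ciSup_le` only over a nonempty family. -/
instance (d : ℕ) : Nonempty (boundedSubclass (linearClass d) 4) :=
  ⟨⟨fun _ => 0, ⟨0, by simp⟩, by simp⟩⟩

theorem swapRegret_le {T N : ℕ} (x : Fin T → contextSet d) (y : Fin T → ℝ)
    (p : Fin T → Fin (N + 1)) {R : ℝ}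
    (h : ∀ θ : Fin (N + 1) → EuclideanSpace ℝ (Fin d),
      (∀ k, ∀ x : contextSet d, inner ℝ (θ k) (x : EuclideanSpace ℝ (Fin d)) ^ 2 ≤ 4) →
      ∑ t, ((((p t : ℕ) : ℝ) / N - y t) ^ 2 -
        (inner ℝ (θ (p t)) (x t : EuclideanSpace ℝ (Fin d)) - y t) ^ 2) ≤ R) :
    swapRegret (boundedSubclass (linearClass d) 4) x y p ≤ R := by
  refine ciSup_le fun f => ?_
  choose θ hθ using fun k => (f k).2.1
  have := h θ fun k z => by rw [← hθ]; exact (f k).2.2 z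
  simpa only [hθ] using this

theorem sq_grid_sub_le_one {N : ℕ} (k : Fin (N + 1)) {y : ℝ} (hy : y = 0 ∨ y = 1) :
    (((k : ℕ) : ℝ) / N - y) ^ 2 ≤ 1 := by
  have h0 : (0 : ℝ) ≤ ((k : ℕ) : ℝ) / N := by positivity
  have h1 : ((k : ℕ) : ℝ) / N ≤ 1 :=
    div_le_one_of_le₀ (by exact_mod_cast Nat.lt_succ_iff.1 k.2) (Nat.cast_nonneg _)
  rcases hy with rfl | rfl <;> nlinarith

theorem swapRegret_le_horizon {T N : ℕ} (x : Fin T → contextSet d) {y : Fin T → ℝ}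
    (hy : ∀ t, y t = 0 ∨ y t = 1) (p : Fin T → Fin (N + 1)) :
    swapRegret (boundedSubclass (linearClass d) 4) x y p ≤ T := by
  refine swapRegret_le x y p fun θ _ => ?_
  calc _ ≤ ∑ _t : Fin T, (1 : ℝ) := Finset.sum_le_sum fun t _ => by
        have := sq_grid_sub_le_one (p t) (hy t)
        have := sq_nonneg (inner ℝ (θ (p t)) (x t : EuclideanSpace ℝ (Fin d)) - y t)
        linarith
    _ = T := by simp

/-- If the pseudo swap regret against vectors of norm at most `5` is small, then so is the swap
regret against bounded linear functions with high probability. -/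
theorem swapRegret_high_probability {T N : ℕ} (hd : 1 ≤ d) (hT : 2 ≤ T) (x : Fin T → contextSet d)
    {y : Fin T → ℝ} (hy : ∀ t, y t = 0 ∨ y t = 1) (P : Fin T → PMF (Fin (N + 1))) {R : ℝ}
    (hP : ∀ ϑ : Fin (N + 1) → EuclideanSpace ℝ (Fin d), (∀ k, ‖ϑ k‖ ≤ 5) →
      ∑ t, ∑ k : Fin (N + 1), (P t k).toReal * ((((k : ℕ) : ℝ) / N - y t) ^ 2 -
        (inner ℝ (ϑ k) (x t : EuclideanSpace ℝ (Fin d)) - y t) ^ 2) ≤ R)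
    {δ : ℝ} (hδ : 0 < δ) (hδ1 : δ ≤ 1) :
    1 - δ ≤ (predictionLaw P).real
      {p | swapRegret (boundedSubclass (linearClass d) 4) x y p ≤ R + 8 +
        17 * Real.sqrt (T * (d * (N + 1) * Real.log (10 * d * T + 1) + Real.log (1 / δ)))} := by
  classical
  -- With this mesh the net has accuracy d/D = 1/T, so rounding the comparators costs O(1/T) per
  -- round and at most 8 in total.
  set D := d * T with hDdef
  have hD : 0 < D := by positivity
  have hT' : (2 : ℝ) ≤ T := by exact_mod_cast hT
  have hTinv : (1 : ℝ) / T ≤ 1 / 2 := one_div_le_one_div_of_le two_pos hT'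
  have hdD : (d : ℝ) / D = 1 / T := by
    rw [hDdef]; push_cast
    have : (d : ℝ) ≠ 0 := by positivity
    field_simp
  set net : Finset (Fin d → ℤ) :=
    Fintype.piFinset fun _ : Fin d => Finset.Icc (-(5 * D : ℤ)) (5 * D)
  set loss : (Fin (N + 1) → Fin d → ℤ) → Fin T → Fin (N + 1) → ℝ := fun z t k =>
    (((k : ℕ) : ℝ) / N - y t) ^ 2 -
      (inner ℝ (gridVector D (z k)) (x t : EuclideanSpace ℝ (Fin d)) - y t) ^ 2 with hloss
  -- Only profiles with losses in [-16, 1] are kept, for Hoeffding's inequality with range 17, and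
  -- with norms at most 5, for `hP`. The roundings of admissible comparators pass both tests: their
  -- values are at most 2 + 1/T in absolute value and their norms at most 4 + 1/T.
  set profiles : Finset (Fin (N + 1) → Fin d → ℤ) :=
    (Fintype.piFinset fun _ => net).filter fun z =>
      (∀ t k, loss z t k ∈ Set.Icc (-16 : ℝ) 1) ∧ ∀ k, ‖gridVector D (z k)‖ ≤ 5 with hprof
  have hcard : (profiles.card : ℝ) ≤ (10 * d * T + 1) ^ (d * (N + 1)) := by
    have h1 : profiles.card ≤ (10 * D + 1) ^ (d * (N + 1)) := by
      refine (Finset.card_filter_le _ _).trans ?_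
      simp only [net, Fintype.card_piFinset, Int.card_Icc, Finset.prod_const, Finset.card_univ,
        Fintype.card_fin]
      rw [← pow_mul]
      apply le_of_eq
      congr 1
      omega
    calc (profiles.card : ℝ) ≤ (((10 * D + 1) ^ (d * (N + 1)) : ℕ) : ℝ) := by exact_mod_cast h1
      _ = _ := by rw [hDdef]; push_cast; ring
  have hgrid0 : gridVector D (0 : Fin d → ℤ) = 0 := by ext i; simp [gridVector]
  have hne : profiles.Nonempty := by
    refine ⟨fun _ => 0, ?_⟩
    simp only [hprof, Finset.mem_filter, Fintype.mem_piFinset, net, Finset.mem_Icc, hgrid0, hloss]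
    refine ⟨fun _ _ => ⟨by simp, by simp⟩, fun t k => ?_, by simp⟩
    have h1 := sq_grid_sub_le_one k (hy t)
    have h2 := sq_nonneg (((k : ℕ) : ℝ) / N - y t)
    simp only [inner_zero_left]
    rcases hy t with h | h <;> rw [h] at h1 h2 ⊢ <;> constructor <;> linarith
  set G := profiles.image loss
  have hGne : G.Nonempty := hne.image _
  set ε := 17 * Real.sqrt (T * (d * (N + 1) * Real.log (10 * d * T + 1) + Real.log (1 / δ)))
    with hε
  have hbad := pi_pmf_uniform_hoeffding (by omega : 0 < T) P G hGne (a := -16) (b := 1)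
    (by norm_num) (by
      intro h hh
      obtain ⟨z, hz, rfl⟩ := Finset.mem_image.1 hh
      exact (Finset.mem_filter.1 hz).2.1) hδ hδ1
  set bad := {p : Fin T → Fin (N + 1) | ∃ h ∈ G, ∑ t, ∑ k, (P t k).toReal * h t k +
        (1 - -16) * Real.sqrt (T * (Real.log G.card + Real.log (1 / δ))) ≤ ∑ t, h t (p t)}
    with hbaddef
  have hεle : (1 - -16) * Real.sqrt (T * (Real.log G.card + Real.log (1 / δ))) ≤ ε := by
    rw [hε, show (1 - -16 : ℝ) = 17 by norm_num]
    have hG0 : (0 : ℝ) < G.card := by exact_mod_cast hGne.card_pos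
    have hGc : (G.card : ℝ) ≤ (10 * d * T + 1) ^ (d * (N + 1)) :=
      le_trans (by exact_mod_cast Finset.card_image_le) hcard
    have := Real.log_le_log hG0 hGc
    rw [Real.log_pow] at this
    push_cast at this
    gcongr
  have hsub : badᶜ ⊆ {p | swapRegret (boundedSubclass (linearClass d) 4) x y p ≤ R + 8 + ε} := by
    intro p hp
    refine swapRegret_le x y p fun θ hθ => ?_
    choose z hz hzθ using fun k => exists_gridVector_near hD (θ k)
      (norm_le_of_bounded_on_contextSet hd (θ k) (hθ k))
    rw [hdD] at hzθ
    have hdiff : ∀ k t, |inner ℝ (θ k) (x t : EuclideanSpace ℝ (Fin d)) -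
        inner ℝ (gridVector D (z k)) (x t : EuclideanSpace ℝ (Fin d))| ≤ 1 / T := fun k t => by
      rw [← inner_sub_left]
      refine (abs_real_inner_le_norm _ _).trans ?_
      have h1 := (x t).2.1
      have h2 := hzθ k
      have h3 := norm_nonneg (θ k - gridVector D (z k))
      nlinarith
    have hval : ∀ k t, |inner ℝ (θ k) (x t : EuclideanSpace ℝ (Fin d))| ≤ 2 := fun k t =>
      abs_le_of_sq_le_sq (by have := hθ k (x t); linarith) (by norm_num)
    have hz5 : ∀ k, ‖gridVector D (z k)‖ ≤ 5 := fun k => by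
      have h1 := norm_le_of_bounded_on_contextSet hd (θ k) (hθ k)
      have h2 := norm_sub_norm_le (gridVector D (z k)) (θ k)
      rw [norm_sub_rev] at h2
      linarith [hzθ k]
    have hmem : z ∈ profiles := by
      refine Finset.mem_filter.2 ⟨Fintype.mem_piFinset.2 hz, fun t k => ?_, hz5⟩
      have h1 := sq_grid_sub_le_one k (hy t)
      have h2 := sq_nonneg (((k : ℕ) : ℝ) / N - y t)
      obtain ⟨h3, h3'⟩ := abs_le.1 (hdiff k t)
      obtain ⟨h4, h4'⟩ := abs_le.1 (hval k t)
      set v := inner ℝ (gridVector D (z k)) (x t : EuclideanSpace ℝ (Fin d)) with hv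
      have h5 : (v - y t) ^ 2 ≤ 4 ^ 2 := by
        apply sq_le_sq'
        · rcases hy t with h | h <;> rw [h] <;> linarith
        · rcases hy t with h | h <;> rw [h] <;> linarith
      constructor
      · simp only [hloss]; linarith
      · simp only [hloss]; linarith [sq_nonneg (v - y t)]
    -- Outside the bad event the realized regret of a net profile exceeds its pseudo regret, at most
    -- R, by at most ε.
    have hgood : ∑ t, loss z t (p t) ≤ R + ε := by
      by_contra! hcon
      refine hp ⟨loss z, Finset.mem_image_of_mem _ hmem, ?_⟩
      have := hP (fun k => gridVector D (z k)) hz5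
      simp only [hloss] at hcon ⊢
      linarith
    have hstep : ∀ t, (((p t : ℕ) : ℝ) / N - y t) ^ 2 -
        (inner ℝ (θ (p t)) (x t : EuclideanSpace ℝ (Fin d)) - y t) ^ 2 ≤
          loss z t (p t) + 8 * (1 / T) := fun t => by
      simp only [hloss]
      obtain ⟨h4, h4'⟩ := abs_le.1 (hval (p t) t)
      have h3 := hdiff (p t) t
      set v := inner ℝ (gridVector D (z (p t))) (x t : EuclideanSpace ℝ (Fin d)) with hv
      set u := inner ℝ (θ (p t)) (x t : EuclideanSpace ℝ (Fin d)) with hu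
      have h6 : |v + u - 2 * y t| ≤ 8 := by
        obtain ⟨h3, h3'⟩ := abs_le.1 h3
        rw [abs_le]
        rcases hy t with h | h <;> rw [h] <;> constructor <;> linarith
      have h7 : (v - y t) ^ 2 - (u - y t) ^ 2 ≤ 8 * (1 / T) := by
        calc _ = (v + u - 2 * y t) * (v - u) := by ring
          _ ≤ |(v + u - 2 * y t) * (v - u)| := le_abs_self _
          _ = |v + u - 2 * y t| * |u - v| := by rw [abs_mul, abs_sub_comm u v]
          _ ≤ 8 * (1 / T) := by gcongr
      linarith
    calc _ ≤ ∑ t, (loss z t (p t) + 8 * (1 / T)) := Finset.sum_le_sum fun t _ => hstep t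
      _ = ∑ t, loss z t (p t) + 8 := by
        rw [Finset.sum_add_distrib]
        simp only [Finset.sum_const, Finset.card_univ, Fintype.card_fin, nsmul_eq_mul]
        field_simp
      _ ≤ _ := by linarith
  have hmeas : MeasurableSet bad := (Set.toFinite _).measurableSet
  calc 1 - δ ≤ 1 - (predictionLaw P).real bad := by
        have : (predictionLaw P).real bad ≤ δ := hbad
        linarith
    _ = (predictionLaw P).real badᶜ := by
        have : IsProbabilityMeasure (predictionLaw P) := by unfold predictionLaw; infer_instance
        rw [probReal_compl_eq_one_sub hmeas]
    _ ≤ _ := by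
        have : IsProbabilityMeasure (predictionLaw P) := by unfold predictionLaw; infer_instance
        exact measureReal_mono hsub

end LinearClass

/-! ### The rates -/

section Rates

variable {d T : ℕ}

theorem half_le_log (hT : 2 ≤ T) : (1 / 2 : ℝ) ≤ Real.log T := by
  have h1 : Real.log 2 ≤ Real.log T := Real.log_le_log two_pos (by exact_mod_cast hT)
  linarith [Real.log_two_gt_d9]

theorem half_le_mul_log (hd : 1 ≤ d) (hT : 2 ≤ T) : (1 / 2 : ℝ) ≤ d * Real.log T := by
  have h1 := half_le_log hT
  have h2 : (1 : ℝ) ≤ d := by exact_mod_cast hd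
  nlinarith

theorem gridSize_pos (hd : 1 ≤ d) (hT : 2 ≤ T) : 0 < gridSize d T := by
  have h := half_le_mul_log hd hT
  have hT' : (0 : ℝ) < T := by positivity
  exact Nat.ceil_pos.2 (Real.rpow_pos_of_pos (div_pos hT' (by linarith)) _)

theorem gridSize_le (hd : 1 ≤ d) (hT : 2 ≤ T) : gridSize d T ≤ 2 * T := by
  have h := half_le_mul_log hd hT
  have hT' : (2 : ℝ) ≤ T := by exact_mod_cast hT
  refine Nat.ceil_le.2 ?_
  push_cast
  have h1 : (T : ℝ) / (d * Real.log T) ≤ 2 * T := by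
    rw [div_le_iff₀ (by linarith)]; nlinarith
  calc _ ≤ (2 * T : ℝ) ^ (1 / 5 : ℝ) :=
        Real.rpow_le_rpow (div_nonneg (by linarith) (by linarith)) h1 (by norm_num)
    _ ≤ (2 * T : ℝ) ^ (1 : ℝ) :=
        Real.rpow_le_rpow_of_exponent_le (by linarith) (by norm_num)
    _ = 2 * T := Real.rpow_one _

/-- All quantities in the bounds, expressed by the tenth roots of `T` and `d log T`. -/
theorem exists_tenth_roots (hd : 1 ≤ d) (hT : 2 ≤ T) :
    ∃ a b : ℝ, 0 < a ∧ 0 < b ∧ (T : ℝ) = a ^ 10 ∧ d * Real.log T = b ^ 10 ∧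
      (T : ℝ) ^ (3 / 5 : ℝ) = a ^ 6 ∧ (d * Real.log T) ^ (2 / 5 : ℝ) = b ^ 4 ∧
      (d * Real.log T) ^ (-(1 / 10) : ℝ) = b⁻¹ ∧
      ((T : ℝ) / (d * Real.log T)) ^ (1 / 5 : ℝ) = a ^ 2 / b ^ 2 := by
  have hL : 0 < d * Real.log T := by linarith [half_le_mul_log hd hT]
  have hT' : (0 : ℝ) < T := by positivity
  have hroot : ∀ {z : ℝ}, 0 < z → ∀ (n : ℕ) (r : ℝ), r = n / 10 →
      z ^ r = (z ^ (1 / 10 : ℝ)) ^ n := fun {z} hz n r hr => by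
    rw [← Real.rpow_mul_natCast hz.le, hr]; congr 1; ring
  refine ⟨(T : ℝ) ^ (1 / 10 : ℝ), (d * Real.log T) ^ (1 / 10 : ℝ), Real.rpow_pos_of_pos hT' _,
    Real.rpow_pos_of_pos hL _, ?_, ?_, hroot hT' 6 _ (by norm_num), hroot hL 4 _ (by norm_num),
    Real.rpow_neg hL.le _, ?_⟩
  · rw [← hroot hT' 10 1 (by norm_num), Real.rpow_one]
  · rw [← hroot hL 10 1 (by norm_num), Real.rpow_one]
  · rw [Real.div_rpow hT'.le hL.le, hroot hT' 2 _ (by norm_num), hroot hL 2 _ (by norm_num)]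

/-- Since log T ≥ 1/2, the assumption forces d ≤ 2T, and all logarithms become comparable to log T.
-/
theorem mul_log_le (hd : 1 ≤ d) (hT : 2 ≤ T) (hLT : d * Real.log T ≤ T) :
    d * Real.log (d + T) ≤ 3 * (d * Real.log T) ∧
      d * Real.log (10 * d * T + 1) ≤ 7 * (d * Real.log T) := by
  have hlogT := half_le_log hT
  have hT' : (2 : ℝ) ≤ T := by exact_mod_cast hT
  have hd' : (1 : ℝ) ≤ d := by exact_mod_cast hd
  have hd2T : (d : ℝ) ≤ 2 * T := by nlinarith
  have h2 : (4 : ℝ) ≤ (T : ℝ) ^ 2 := by nlinarith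
  constructor
  · have : Real.log (d + T) ≤ 3 * Real.log T := by
      rw [show (3 : ℝ) = (3 : ℕ) by norm_num, ← Real.log_pow]
      refine Real.log_le_log (by linarith) ?_
      calc (d + T : ℝ) ≤ 4 * T := by linarith
        _ ≤ (T : ℝ) ^ 2 * T := by gcongr
        _ = _ := by ring
    calc _ ≤ d * (3 * Real.log T) := by gcongr
      _ = _ := by ring
  · have : Real.log (10 * d * T + 1) ≤ 7 * Real.log T := by
      rw [show (7 : ℝ) = (7 : ℕ) by norm_num, ← Real.log_pow]
      refine Real.log_le_log (by positivity) ?_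
      have h5 : (32 : ℝ) ≤ (T : ℝ) ^ 5 := by
        calc (32 : ℝ) = 2 ^ 5 := by norm_num
          _ ≤ _ := pow_le_pow_left₀ two_pos.le hT' 5
      have h6 : (d : ℝ) * T ≤ 2 * T * T := by gcongr
      calc _ ≤ 32 * (T : ℝ) ^ 2 := by nlinarith
        _ ≤ (T : ℝ) ^ 5 * (T : ℝ) ^ 2 := by gcongr
        _ = _ := by ring
    calc _ ≤ d * (7 * Real.log T) := by gcongr
      _ = _ := by ring

/-- With T = a¹⁰ and d log T = b¹⁰, the target is M = a⁶b⁴ and N is of order a²/b². Then T/N² is of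
order M, T·N·d log T of order a¹²b⁸ = M², and N·d log T of order a²b⁸ ≤ M. -/
theorem high_probability_rate (hd : 1 ≤ d) (hT : 2 ≤ T) (hLT : d * Real.log T ≤ T) {l : ℝ}
    (hl : 0 ≤ l) :
    (T : ℝ) / (4 * (gridSize d T : ℝ) ^ 2) +
      (gridSize d T + 1) * (5 ^ 2 + d * Real.log (d + T)) + 8 +
      17 * Real.sqrt (T * (d * (gridSize d T + 1) * Real.log (10 * d * T + 1) + l)) ≤
    400 * ((T : ℝ) ^ (3 / 5 : ℝ) * (d * Real.log T) ^ (2 / 5 : ℝ) +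
      (T : ℝ) ^ (3 / 5 : ℝ) * (d * Real.log T) ^ (-(1 / 10) : ℝ) * Real.sqrt l) := by
  have hgpos := gridSize_pos hd hT
  have hL2 := half_le_mul_log hd hT
  have hlogT := half_le_log hT
  have hT' : (2 : ℝ) ≤ T := by exact_mod_cast hT
  have hd' : (1 : ℝ) ≤ d := by exact_mod_cast hd
  obtain ⟨a, b, ha, hb, hTa, hLb, e1, e2, e3, e4⟩ := exists_tenth_roots hd hT
  have hN1 : a ^ 2 / b ^ 2 ≤ gridSize d T := by rw [← e4]; exact Nat.le_ceil _
  have hba : b ≤ a := by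
    rw [hLb, hTa] at hLT
    exact le_of_pow_le_pow_left₀ (by norm_num) ha.le hLT
  -- Hence the ceiling in the definition of N at most doubles the ratio.
  have hr1 : 1 ≤ a ^ 2 / b ^ 2 := by
    rw [one_le_div (by positivity)]; exact pow_le_pow_left₀ hb.le hba 2
  have hN2 : (gridSize d T : ℝ) ≤ 2 * (a ^ 2 / b ^ 2) := by
    have : (gridSize d T : ℝ) < a ^ 2 / b ^ 2 + 1 := by
      rw [← e4]; exact Nat.ceil_lt_add_one (by rw [e4]; positivity)
    linarith
  set N : ℝ := ((gridSize d T : ℕ) : ℝ) with hN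
  have hNone : 1 ≤ N := by rw [hN]; exact_mod_cast hgpos
  set L := d * Real.log T with hL
  obtain ⟨hlog1, hlog2⟩ := mul_log_le hd hT hLT
  have hNL : N * L ≤ 2 * (a ^ 2 * b ^ 8) := by
    calc N * L ≤ 2 * (a ^ 2 / b ^ 2) * b ^ 10 := by rw [hLb]; gcongr
      _ = _ := by field_simp
  have hM1 : a ^ 2 * b ^ 8 ≤ a ^ 6 * b ^ 4 := by
    calc a ^ 2 * b ^ 8 = a ^ 2 * b ^ 4 * b ^ 4 := by ring
      _ ≤ a ^ 2 * a ^ 4 * b ^ 4 := by gcongr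
      _ = _ := by ring
  have hM2 : L ≤ a ^ 6 * b ^ 4 := by
    calc L = b ^ 6 * b ^ 4 := by rw [hLb]; ring
      _ ≤ a ^ 6 * b ^ 4 := by gcongr
  rw [e1, e2, e3]
  set M := a ^ 6 * b ^ 4 with hMdef
  have hM0 : 0 < M := by positivity
  have t1 : (T : ℝ) / (4 * N ^ 2) ≤ M := by
    calc (T : ℝ) / (4 * N ^ 2) ≤ (T : ℝ) / (4 * (a ^ 2 / b ^ 2) ^ 2) := by gcongr
      _ = M / 4 := by rw [hTa, hMdef]; field_simp
      _ ≤ M := by linarith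
  have t2 : (N + 1) * (5 ^ 2 + d * Real.log (d + T)) ≤ 212 * M := by
    calc _ ≤ (N + N) * (50 * L + 3 * L) := by
          have : (5 : ℝ) ^ 2 ≤ 50 * L := by linarith
          have : 0 ≤ d * Real.log (d + T) :=
            mul_nonneg (by linarith) (Real.log_nonneg (by linarith))
          gcongr
      _ = 106 * (N * L) := by ring
      _ ≤ 212 * M := by linarith
  have t3 : Real.sqrt (T * (d * (N + 1) * Real.log (10 * d * T + 1) + l)) ≤
      6 * M + a ^ 6 * b⁻¹ * Real.sqrt l := by
    have hs := Real.sqrt_nonneg l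
    refine Real.sqrt_le_iff.2 ⟨by positivity, ?_⟩
    have h1 : (T : ℝ) * (d * (N + 1) * Real.log (10 * d * T + 1)) ≤ 28 * M ^ 2 := by
      calc _ = (T : ℝ) * ((N + 1) * (d * Real.log (10 * d * T + 1))) := by ring
        _ ≤ (T : ℝ) * ((N + N) * (7 * L)) := by
          have : 0 ≤ d * Real.log (10 * d * T + 1) :=
            mul_nonneg (by linarith) (Real.log_nonneg (by
              have : (0 : ℝ) ≤ 10 * d * T := by positivity
              linarith))
          gcongr
        _ = 14 * (T : ℝ) * (N * L) := by ring
        _ ≤ 14 * (T : ℝ) * (2 * (a ^ 2 * b ^ 8)) := by gcongr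
        _ = 28 * M ^ 2 := by rw [hTa, hMdef]; ring
    have h2 : (T : ℝ) * l ≤ (a ^ 6 * b⁻¹ * Real.sqrt l) ^ 2 := by
      rw [mul_pow, Real.sq_sqrt hl]
      gcongr
      rw [hTa]
      calc a ^ 10 = (a ^ 5 * 1) ^ 2 := by ring
        _ ≤ (a ^ 5 * (a * b⁻¹)) ^ 2 := by
          gcongr
          rw [← div_eq_mul_inv, one_le_div hb]; exact hba
        _ = _ := by ring
    have h3 : 0 ≤ M * (a ^ 6 * b⁻¹ * Real.sqrt l) := by positivity
    nlinarith
  have hs : 0 ≤ a ^ 6 * b⁻¹ * Real.sqrt l := by positivity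
  -- The terms add up to at most (1 + 212 + 16 + 102) M, where 8 ≤ 16 M because M ≥ d log T ≥ 1/2.
  linarith

theorem horizon_le_rate (hd : 1 ≤ d) (hT : 2 ≤ T) (hLT : T ≤ d * Real.log T) :
    (T : ℝ) ≤ (T : ℝ) ^ (3 / 5 : ℝ) * (d * Real.log T) ^ (2 / 5 : ℝ) := by
  obtain ⟨a, b, ha, hb, hTa, hLb, e1, e2, -, -⟩ := exists_tenth_roots hd hT
  rw [e1, e2]
  have hab : a ≤ b := by
    rw [hLb, hTa] at hLT
    exact le_of_pow_le_pow_left₀ (by norm_num) hb.le hLT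
  calc (T : ℝ) = a ^ 6 * a ^ 4 := by rw [hTa]; ring
    _ ≤ a ^ 6 * b ^ 4 := by gcongr

/-- At δ = 1/T the deviation factor √(log T) is at most b⁵, where b¹⁰ = d log T, so the deviation
term is absorbed in the main one. -/
theorem expectation_rate (hd : 1 ≤ d) (hT : 2 ≤ T) (hLT : d * Real.log T ≤ T) :
    400 * ((T : ℝ) ^ (3 / 5 : ℝ) * (d * Real.log T) ^ (2 / 5 : ℝ) +
      (T : ℝ) ^ (3 / 5 : ℝ) * (d * Real.log T) ^ (-(1 / 10) : ℝ) * Real.sqrt (Real.log T)) + 1 ≤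
    1000 * ((T : ℝ) ^ (3 / 5 : ℝ) * (d * Real.log T) ^ (2 / 5 : ℝ)) := by
  have hL2 := half_le_mul_log hd hT
  have hd' : (1 : ℝ) ≤ d := by exact_mod_cast hd
  have hlogT := half_le_log hT
  obtain ⟨a, b, ha, hb, hTa, hLb, e1, e2, e3, -⟩ := exists_tenth_roots hd hT
  rw [e1, e2, e3]
  have hba : b ≤ a := by
    rw [hLb, hTa] at hLT
    exact le_of_pow_le_pow_left₀ (by norm_num) ha.le hLT
  have hs : Real.sqrt (Real.log T) ≤ b ^ 5 := by
    refine Real.sqrt_le_iff.2 ⟨by positivity, ?_⟩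
    calc Real.log T ≤ d * Real.log T := by nlinarith
      _ = (b ^ 5) ^ 2 := by rw [hLb]; ring
  have h1 : a ^ 6 * b⁻¹ * Real.sqrt (Real.log T) ≤ a ^ 6 * b ^ 4 := by
    calc _ ≤ a ^ 6 * b⁻¹ * b ^ 5 := by gcongr
      _ = _ := by field_simp
  have h2 : d * Real.log T ≤ a ^ 6 * b ^ 4 := by
    calc d * Real.log T = b ^ 6 * b ^ 4 := by rw [hLb]; ring
      _ ≤ a ^ 6 * b ^ 4 := by gcongr
  linarith

end Rates

/-! ### Assembly of the two regimes -/

theorem mainTheorem4 :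
    ∃ (A : OnlineProgram) (K : ℕ) (C : ℝ),
      ∀ (d T : ℕ), 1 ≤ d → 2 ≤ T →
      ∀ (x : ℕ → contextSet d) (y : ℕ → ℝ), (∀ t, y t = 0 ∨ y t = 1) →
        A.totalTime d T (gridSize d T) x y ≤ K * (d + T) ^ K ∧
        ∃ P : Fin T → PMF (Fin (gridSize d T + 1)),
          A.Outputs d T (gridSize d T) x y P ∧
          (∀ δ : ℝ, 0 < δ → δ ≤ 1 →
            1 - δ ≤ (predictionLaw P).real
              {p | swapRegret (boundedSubclass (linearClass d) 4)
                    (fun t : Fin T => x t) (fun t : Fin T => y t) p ≤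
                  C * ((T : ℝ) ^ (3 / 5 : ℝ) * (d * Real.log T) ^ (2 / 5 : ℝ) +
                    (T : ℝ) ^ (3 / 5 : ℝ) * (d * Real.log T) ^ (-(1 / 10) : ℝ) *
                      Real.sqrt (Real.log (1 / δ)))}) ∧
          ∫ p, swapRegret (boundedSubclass (linearClass d) 4)
              (fun t : Fin T => x t) (fun t : Fin T => y t) p ∂(predictionLaw P) ≤
            C * ((T : ℝ) ^ (3 / 5 : ℝ) * (d * Real.log T) ^ (2 / 5 : ℝ)) := by
  -- One K must serve as coefficient and as exponent; keeping it a variable avoids evaluating a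
  -- power with exponent 1000.
  obtain ⟨K, hK⟩ : ∃ K, K = 1000 := ⟨_, rfl⟩
  refine ⟨Forecaster.program, K, 1000, fun d T hd hT x y hy => ⟨?_, ?_⟩⟩
  · refine (Forecaster.program_totalTime_le_pow T _ x y hd hT (gridSize_le hd hT)).trans ?_
    rw [← hK]
    exact Nat.mul_le_mul_left K (Nat.pow_le_pow_right (by omega) (by omega))
  have hN := gridSize_pos hd hT
  set N := gridSize d T with hNdef
  set P := Forecaster.forecast T N x y hN with hP
  have hprob : IsProbabilityMeasure (predictionLaw P) := by unfold predictionLaw; infer_instance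
  have hL := half_le_mul_log hd hT
  set r₁ := (T : ℝ) ^ (3 / 5 : ℝ) * (d * Real.log T) ^ (2 / 5 : ℝ) with hr₁
  set r₂ := (T : ℝ) ^ (3 / 5 : ℝ) * (d * Real.log T) ^ (-(1 / 10) : ℝ) with hr₂
  have hr₁0 : 0 ≤ r₁ :=
    mul_nonneg (Real.rpow_nonneg (by positivity) _) (Real.rpow_nonneg (by linarith) _)
  have hr₂0 : 0 ≤ r₂ :=
    mul_nonneg (Real.rpow_nonneg (by positivity) _) (Real.rpow_nonneg (by linarith) _)
  have hle : ∀ p : Fin T → Fin (N + 1), swapRegret (boundedSubclass (linearClass d) 4)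
      (fun t : Fin T => x t) (fun t : Fin T => y t) p ≤ T :=
    swapRegret_le_horizon _ fun t => hy t
  refine ⟨P, Forecaster.program_outputs T N x y hN, ?_⟩
  -- If T ≤ d log T the rate is at least T, which bounds the regret for every outcome of the draws.
  rcases le_total (T : ℝ) (d * Real.log T) with hLT | hLT
  · have hrate : (T : ℝ) ≤ r₁ := horizon_le_rate hd hT hLT
    constructor
    · intro δ hδ hδ1
      have hall : {p : Fin T → Fin (N + 1) | swapRegret (boundedSubclass (linearClass d) 4)
          (fun t : Fin T => x t) (fun t : Fin T => y t) p ≤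
            1000 * (r₁ + r₂ * Real.sqrt (Real.log (1 / δ)))} = Set.univ := by
        refine Set.eq_univ_of_forall fun p => (hle p).trans ?_
        have : 0 ≤ r₂ * Real.sqrt (Real.log (1 / δ)) := by positivity
        linarith
      rw [hall, probReal_univ]
      linarith
    · calc _ ≤ ∫ _p, (T : ℝ) ∂(predictionLaw P) := integral_mono .of_finite .of_finite hle
        _ = T := by simp
        _ ≤ _ := by linarith
  have htail : ∀ δ : ℝ, 0 < δ → δ ≤ 1 → 1 - δ ≤ (predictionLaw P).real
      {p | swapRegret (boundedSubclass (linearClass d) 4)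
        (fun t : Fin T => x t) (fun t : Fin T => y t) p ≤
          400 * (r₁ + r₂ * Real.sqrt (Real.log (1 / δ)))} := fun δ hδ hδ1 => by
    have h := swapRegret_high_probability hd hT (fun t : Fin T => x t) (fun t : Fin T => hy t) P
      (fun ϑ hϑ => Forecaster.forecast_pseudo_regret T N x y hN hy ϑ hϑ) hδ hδ1
    refine h.trans (measureReal_mono fun p hp => ?_)
    rw [Set.mem_ofPred_eq] at hp ⊢
    refine hp.trans ?_
    exact high_probability_rate hd hT hLT
      (Real.log_nonneg (by rw [le_div_iff₀ hδ]; linarith))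
  constructor
  · refine fun δ hδ hδ1 => (htail δ hδ hδ1).trans (measureReal_mono fun p hp => ?_)
    rw [Set.mem_ofPred_eq] at hp ⊢
    refine hp.trans ?_
    have : 0 ≤ r₂ * Real.sqrt (Real.log (1 / δ)) := by positivity
    linarith
  · have hT' : (2 : ℝ) ≤ T := by exact_mod_cast hT
    -- With δ = 1/T the failure event contributes at most T · (1/T) = 1.
    have h := integral_le_add_of_tail hle (by linarith) (by positivity)
      (htail (1 / T) (by positivity) (by rw [div_le_one (by linarith)]; linarith))
    refine h.trans ?_
    rw [one_div_one_div, mul_one_div_cancel (by linarith)]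
    exact expectation_rate hd hT hLT
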